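/- Let $(X,\mu)$ be a standard probability space (a standard Borel space with a non-atomic Borel probability measure), let $\mathrm{Aut}(X,\mu)$ be the group of measure-preserving Borel bijections of $X$ modulo equality $\mu$-almost everywhere, and let $T\in\mathrm{Aut}(X,\mu)$ be ergodic. Let $[T]$ be the group of all $S\in\mathrm{Aut}(X,\mu)$ such that for almost every $x$ there is $n\in\mathbb Z$ with $S(x)=T^n(x)$; since almost every $T$-orbit is infinite, this $n=:c_S(x)$ is unique for almost every $x$. The $\mathrm L^1$ full group of $T$ is $$[T]_1=\Big\{S\in[T]:\int_X|c_S|\,d\mu<+\infty\Big\},$$ with the topology of the metric $d(S,S')=\int_X|c_S-c_{S'}|\,d\mu$, and the index of $S\in[T]_1$ is $I(S)=\int_X c_S\,d\mu$. Let $\overline{D([T]_1)}$ be the closure in $[T]_1$ of the derived (commutator) subgroup of $[T]_1$. Then $\overline{D([T]_1)}$ is equal to each of the following: - the kernel $\{S\in[T]_1: I(S)=0\}$ of the index map; - the subgroup of $[T]_1$ generated by its periodic elements, i.e. those almost all of whose orbits are finite; - the closure of the subgroup of $[T]_1$ generated by the involutions of $[T]_1$; - the connected component of the identity in $[T]_1$.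 Moreover, the index map is a surjective group homomorphism $I:[T]_1\to\mathbb Z$ (in particular it takes integer values), so that there is a short exact sequence $$1\to\overline{D([T]_1)}\to[T]_1\xrightarrow{\;I\;}\mathbb Z\to1 .$$ -/

import Mathlib

open MeasureTheory
open scoped ENNReal

namespace L1Full

noncomputable section

/-- The group of measure-preserving transformations of `(X, μ)`: the bijections of `X` which,
together with their inverse, are measurable and preserve `μ`. -/
def mpGroup {X : Type*} [MeasurableSpace X] (μ : Measure X) : Subgroup (Equiv.Perm X) where
  carrier := {e | MeasurePreserving e μ μ ∧ MeasurePreserving e.symm μ μ}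
  one_mem' := ⟨MeasurePreserving.id μ, MeasurePreserving.id μ⟩
  mul_mem' := fun ha hb => ⟨ha.1.comp hb.1, hb.2.comp ha.2⟩
  inv_mem' := fun ha => ⟨ha.2, ha.1⟩

/-- The measure-preserving transformations that coincide with the identity up to measure zero. -/
def aeTrivial {X : Type*} [MeasurableSpace X] (μ : Measure X) : Subgroup (mpGroup μ) where
  carrier := {e | ∀ᵐ x ∂μ, e.1 x = x}
  one_mem' := by
    change ∀ᵐ x ∂μ, (1 : mpGroup μ).1 x = x
    exact Filter.Eventually.of_forall fun _ => rfl
  mul_mem' := by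
    intro a b ha hb
    filter_upwards [hb, b.2.1.quasiMeasurePreserving.ae ha] with x h1 h2
    change a.1 (b.1 x) = x
    rw [h2, h1]
  inv_mem' := by
    intro a ha
    filter_upwards [a.2.2.quasiMeasurePreserving.ae ha] with x h
    change a.1.symm x = x
    simpa using h.symm

instance aeTrivial_normal {X : Type*} [MeasurableSpace X] (μ : Measure X) :
    (aeTrivial μ).Normal where
  conj_mem := by
    intro n hn g
    change ∀ᵐ x ∂μ, g.1 (n.1 (g.1.symm x)) = x
    filter_upwards [g.2.2.quasiMeasurePreserving.ae hn] with x h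
    rw [h]
    simp

/-- `Aut(X, μ)`: measure-preserving transformations, identified when they coincide up to
measure zero. -/
abbrev Aut {X : Type*} [MeasurableSpace X] (μ : Measure X) : Type _ := mpGroup μ ⧸ aeTrivial μ

/-- The graph metric on the orbits of `T`: the least length `|n|` of a word `T ^ n` in `T` and
`T⁻¹` that maps `x` to `y` (and `∞` if `x` and `y` lie in different orbits). -/
def orbitDist {X : Type*} (T : Equiv.Perm X) (x y : X) : ℝ≥0∞ :=
  ⨅ (n : ℤ) (_ : y = (T ^ n) x), (n.natAbs : ℝ≥0∞)

theorem orbitDist_self {X : Type*} (T : Equiv.Perm X) (x : X) : orbitDist T x x = 0 := by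
  refine le_antisymm ?_ bot_le
  exact iInf₂_le_of_le (0 : ℤ) (by simp) (by simp)

theorem orbitDist_comm_le {X : Type*} (T : Equiv.Perm X) (x y : X) : orbitDist T x y ≤ orbitDist T y x := by
  refine le_iInf₂ fun n hn => iInf₂_le_of_le (-n) ?_ (by simp)
  rw [hn, ← Equiv.Perm.mul_apply, ← zpow_add, neg_add_cancel, zpow_zero, Equiv.Perm.one_apply]

theorem orbitDist_comm {X : Type*} (T : Equiv.Perm X) (x y : X) : orbitDist T x y = orbitDist T y x :=
  le_antisymm (orbitDist_comm_le T x y) (orbitDist_comm_le T y x)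

theorem orbitDist_triangle {X : Type*} (T : Equiv.Perm X) (x y z : X) :
    orbitDist T x z ≤ orbitDist T x y + orbitDist T y z := by
  unfold orbitDist
  simp only [ENNReal.iInf_add, ENNReal.add_iInf]
  refine le_iInf₂ fun m hm => le_iInf₂ fun n hn => ?_
  refine iInf₂_le_of_le (m + n) ?_ ?_
  · rw [hm, hn, ← Equiv.Perm.mul_apply, ← zpow_add]
  · rw [add_comm m n]
    exact_mod_cast Int.natAbs_add_le n m

theorem eq_of_orbitDist_eq_zero {X : Type*} {T : Equiv.Perm X} {x y : X} (h : orbitDist T x y = 0) :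
    x = y := by
  by_contra hne
  have h1 : (1 : ℝ≥0∞) ≤ orbitDist T x y := by
    refine le_iInf₂ fun n hn => ?_
    have : n ≠ 0 := by
      rintro rfl
      exact hne (by simpa using hn.symm)
    exact_mod_cast Nat.one_le_iff_ne_zero.mpr (Int.natAbs_ne_zero.mpr this)
  rw [h] at h1
  exact absurd h1 (by simp)

section

variable {X : Type*} [MeasurableSpace X] {μ : Measure X}

/-- A bijection of `X` representing a class `S ∈ Aut(X, μ)`; two choices agree almost everywhere. -/
def rep (S : Aut μ) : Equiv.Perm X := (Quotient.out S : mpGroup μ).1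

theorem rep_mp (S : Aut μ) : MeasurePreserving (rep S) μ μ := (Quotient.out S : mpGroup μ).2.1

theorem rep_mk (e : mpGroup μ) : ∀ᵐ x ∂μ, rep (e : Aut μ) x = e.1 x := by
  obtain ⟨h, hh⟩ := QuotientGroup.mk_out_eq_mul (aeTrivial μ) e
  have h2 : ∀ᵐ x ∂μ, h.1.1 x = x := h.2
  filter_upwards [h2] with x hx
  change (Quotient.out (e : Aut μ) : mpGroup μ).1 x = e.1 x
  rw [show (Quotient.out (e : Aut μ) : mpGroup μ) = e * h from hh]
  change e.1 (h.1.1 x) = e.1 x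
  rw [hx]

theorem mk_out (S : Aut μ) : ((Quotient.out S : mpGroup μ) : Aut μ) = S := Quotient.out_eq S

theorem rep_one : ∀ᵐ x ∂μ, rep (1 : Aut μ) x = x := rep_mk (1 : mpGroup μ)

theorem rep_mul (S U : Aut μ) : ∀ᵐ x ∂μ, rep (S * U) x = rep S (rep U x) := by
  have h := rep_mk ((Quotient.out S : mpGroup μ) * (Quotient.out U : mpGroup μ))
  rw [QuotientGroup.mk_mul, mk_out, mk_out] at h
  exact h

theorem rep_inv (S : Aut μ) : ∀ᵐ x ∂μ, rep S⁻¹ (rep S x) = x := by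
  filter_upwards [rep_mul S⁻¹ S, rep_one (μ := μ)] with x h1 h2
  rw [← h1, inv_mul_cancel, h2]

theorem ext_rep {S U : Aut μ} (h : ∀ᵐ x ∂μ, rep S x = rep U x) : S = U := by
  rw [← mk_out S, ← mk_out U, QuotientGroup.eq]
  change ∀ᵐ x ∂μ, (rep S).symm (rep U x) = x
  filter_upwards [h] with x hx
  rw [← hx]
  simp

theorem mpGroup_zpow_measurable (T : mpGroup μ) (n : ℤ) : Measurable (T.1 ^ n) := by
  have := (T ^ n).2.1.measurable
  simpa using this

theorem measurable_orbitDist [StandardBorelSpace X] (T : mpGroup μ) {f g : X → X}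
    (hf : Measurable f) (hg : Measurable g) : Measurable fun x => orbitDist T.1 (f x) (g x) := by
  refine Measurable.iInf fun n => ?_
  have hs : MeasurableSet {x | g x = (T.1 ^ n) (f x)} :=
    measurableSet_eq_fun hg ((mpGroup_zpow_measurable T n).comp hf)
  classical
  have : (fun x => ⨅ _ : g x = (T.1 ^ n) (f x), (n.natAbs : ℝ≥0∞)) =
      fun x => {x | g x = (T.1 ^ n) (f x)}.piecewise (fun _ => (n.natAbs : ℝ≥0∞)) (fun _ => ⊤) x := by
    funext x
    by_cases hx : g x = (T.1 ^ n) (f x)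
    · simp [hx]
    · simp [hx]
  rw [this]
  exact Measurable.piecewise hs measurable_const measurable_const

/-- `∫ d_T(S(x), U(x)) dμ(x)`. -/
def l1edist (T : mpGroup μ) (S U : Aut μ) : ℝ≥0∞ := ∫⁻ x, orbitDist T.1 (rep S x) (rep U x) ∂μ

theorem l1edist_self (T : mpGroup μ) (S : Aut μ) : l1edist T S S = 0 := by
  simp [l1edist, orbitDist_self]

theorem l1edist_comm (T : mpGroup μ) (S U : Aut μ) : l1edist T S U = l1edist T U S := by
  simp [l1edist, orbitDist_comm]

theorem measurable_rep_dist [StandardBorelSpace X] (T : mpGroup μ) (S U : Aut μ) :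
    Measurable fun x => orbitDist T.1 (rep S x) (rep U x) :=
  measurable_orbitDist T (rep_mp S).measurable (rep_mp U).measurable

theorem l1edist_triangle [StandardBorelSpace X] (T : mpGroup μ) (S U V : Aut μ) :
    l1edist T S V ≤ l1edist T S U + l1edist T U V := by
  unfold l1edist
  rw [← lintegral_add_left (measurable_rep_dist T S U)]
  exact lintegral_mono fun x => orbitDist_triangle _ _ _ _

theorem l1edist_mul_right [StandardBorelSpace X] (T : mpGroup μ) (S U V : Aut μ) :
    l1edist T (S * V) (U * V) = l1edist T S U := by
  unfold l1edist
  rw [← (rep_mp V).lintegral_comp (measurable_rep_dist T S U)]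
  refine lintegral_congr_ae ?_
  filter_upwards [rep_mul S V, rep_mul U V] with x h1 h2
  rw [h1, h2]

theorem eq_of_l1edist_eq_zero [StandardBorelSpace X] {T : mpGroup μ} {S U : Aut μ}
    (h : l1edist T S U = 0) : S = U := by
  unfold l1edist at h
  rw [lintegral_eq_zero_iff (measurable_rep_dist T S U)] at h
  refine ext_rep ?_
  filter_upwards [h] with x hx
  exact eq_of_orbitDist_eq_zero hx

/-- The full group `[T]`: the classes that map almost every point into its own `T`-orbit. -/
def fullGroup (T : mpGroup μ) : Subgroup (Aut μ) where
  carrier := {S | ∀ᵐ x ∂μ, ∃ n : ℤ, rep S x = (T.1 ^ n) x}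
  one_mem' := by
    filter_upwards [rep_one (μ := μ)] with x hx
    exact ⟨0, by simp [hx]⟩
  mul_mem' := by
    intro S U hS hU
    filter_upwards [hU, (rep_mp U).quasiMeasurePreserving.ae hS, rep_mul S U] with x h1 h2 h3
    obtain ⟨m, hm⟩ := h1
    obtain ⟨n, hn⟩ := h2
    exact ⟨n + m, by rw [h3, hn, hm, zpow_add, Equiv.Perm.mul_apply]⟩
  inv_mem' := by
    intro S hS
    have h := (rep_mp S⁻¹).quasiMeasurePreserving.ae hS
    have h' := rep_inv S⁻¹
    rw [inv_inv] at h'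
    filter_upwards [h, h'] with x h1 h2
    obtain ⟨n, hn⟩ := h1
    refine ⟨-n, ?_⟩
    rw [h2] at hn
    nth_rw 2 [hn]
    rw [← Equiv.Perm.mul_apply, ← zpow_add, neg_add_cancel, zpow_zero, Equiv.Perm.one_apply]

/-- The `L¹` full group `[T]₁`: the elements `S` of the full group `[T]` for which
`x ↦ d_T(x, S(x))` is integrable. -/
def L1FullGroup [StandardBorelSpace X] (T : mpGroup μ) : Subgroup (Aut μ) where
  carrier := {S | S ∈ fullGroup T ∧ ∫⁻ x, orbitDist T.1 x (rep S x) ∂μ < ⊤}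
  one_mem' := by
    refine ⟨one_mem _, ?_⟩
    have : ∫⁻ x, orbitDist T.1 x (rep (1 : Aut μ) x) ∂μ = ∫⁻ _, 0 ∂μ := by
      refine lintegral_congr_ae ?_
      filter_upwards [rep_one (μ := μ)] with x hx
      rw [hx, orbitDist_self]
    rw [this]
    simp
  mul_mem' := by
    rintro S U ⟨hS, hS'⟩ ⟨hU, hU'⟩
    refine ⟨mul_mem hS hU, ?_⟩
    have hm : Measurable fun x => orbitDist T.1 x (rep S x) :=
      measurable_orbitDist T measurable_id (rep_mp S).measurable
    rw [← (rep_mp U).lintegral_comp hm] at hS'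
    refine lt_of_le_of_lt ?_ (ENNReal.add_lt_top.mpr ⟨hU', hS'⟩)
    have hm' : Measurable fun x => orbitDist T.1 x (rep U x) :=
      measurable_orbitDist T measurable_id (rep_mp U).measurable
    rw [← lintegral_add_left hm']
    refine lintegral_mono_ae ?_
    filter_upwards [rep_mul S U] with x hx
    rw [hx]
    exact orbitDist_triangle _ _ _ _
  inv_mem' := by
    rintro S ⟨hS, hS'⟩
    refine ⟨inv_mem hS, ?_⟩
    have hm : Measurable fun x => orbitDist T.1 x (rep S⁻¹ x) :=
      measurable_orbitDist T measurable_id (rep_mp S⁻¹).measurable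
    rw [← (rep_mp S).lintegral_comp hm]
    refine lt_of_le_of_lt (le_of_eq ?_) hS'
    refine lintegral_congr_ae ?_
    filter_upwards [rep_inv S] with x hx
    rw [hx, orbitDist_comm]

theorem l1edist_one_lt_top [StandardBorelSpace X] (T : mpGroup μ) (S : L1FullGroup T) :
    l1edist T 1 S.1 < ⊤ := by
  refine lt_of_le_of_lt (le_of_eq ?_) S.2.2
  refine lintegral_congr_ae ?_
  filter_upwards [rep_one (μ := μ)] with x hx
  rw [hx]

/-- The `L¹` metric `d(S, U) = ∫ d_T(S(x), U(x)) dμ(x)` on `[T]₁`; the group `[T]₁` carries the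
topology that it induces. -/
instance L1FullGroup.instMetricSpace [StandardBorelSpace X] (T : mpGroup μ) :
    MetricSpace (L1FullGroup T) where
  dist S U := (l1edist T S.1 U.1).toReal
  dist_self S := by simp [l1edist_self]
  dist_comm S U := by rw [l1edist_comm]
  dist_triangle S U V := by
    have h : ∀ A B : L1FullGroup T, l1edist T A.1 B.1 ≠ ⊤ := fun A B => by
      refine ne_top_of_le_ne_top ?_ (l1edist_triangle T A.1 1 B.1)
      rw [l1edist_comm T A.1 1]
      exact ENNReal.add_ne_top.mpr ⟨(l1edist_one_lt_top T A).ne, (l1edist_one_lt_top T B).ne⟩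
    rw [← ENNReal.toReal_add (h S U) (h U V)]
    exact ENNReal.toReal_mono (ENNReal.add_ne_top.mpr ⟨h S U, h U V⟩) (l1edist_triangle T _ _ _)
  eq_of_dist_eq_zero := by
    intro S U hSU
    have h : l1edist T S.1 U.1 ≠ ⊤ := by
      refine ne_top_of_le_ne_top ?_ (l1edist_triangle T S.1 1 U.1)
      rw [l1edist_comm T S.1 1]
      exact ENNReal.add_ne_top.mpr ⟨(l1edist_one_lt_top T S).ne, (l1edist_one_lt_top T U).ne⟩
    exact Subtype.ext (eq_of_l1edist_eq_zero (((ENNReal.toReal_eq_zero_iff _).mp hSU).resolve_right h))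

/-- The cocycle `c_S` of `S ∈ [T]`, given by `S(x) = T ^ c_S(x) (x)`. When `T` is aperiodic the
integer `c_S(x)` is unique for almost every `x`. -/
def cocycle (T : mpGroup μ) (S : Aut μ) (x : X) : ℤ :=
  Classical.epsilon fun n : ℤ => rep S x = (T.1 ^ n) x

/-- The index `I(S) = ∫ c_S dμ`. -/
def index [StandardBorelSpace X] (T : mpGroup μ) (S : L1FullGroup T) : ℝ :=
  ∫ x, (cocycle T S.1 x : ℝ) ∂μ

/-- `S ∈ Aut(X, μ)` is periodic if almost all its orbits are finite. -/
def IsPeriodic (S : Aut μ) : Prop := ∀ᵐ x ∂μ, x ∈ Function.periodicPts (rep S)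

end

end

end L1Full

/-!
Write `X₀` for the set of points with infinite `T`-orbit, which is conull by ergodicity and
non-atomicity. Parametrizing the orbit of `x ∈ X₀` by `m ↦ T ^ m x` turns an element `S` of `[T]₁`
into a permutation of `ℤ` (`linePerm`), and the whole proof looks at how such permutations move
points across a cut between two consecutive integers. To argue pointwise, `[T]₁` is replaced by a
group of honest permutations that preserve *every* orbit (`intOrbitGroup`), of which it is a
quotient (`toL1_surjective`).

*The index is a flux.* Almost surely only finitely many points of an orbit cross a given cut. The
number of those that cross to the right minus the number of those that cross to the left does not
depend on the cut, hence is almost everywhere constant, and by invariance of the measure its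
integral is the integral of the cocycle (`hasSum_crossing`). So the index is an integer. As it is
bounded by the distance to the identity, its kernel is open, and therefore also closed; the kernel
contains the derived group, the involutions and the connected component of the identity.

*The kernel is generated by periodic elements* (`exists_periodic_mul_periodic`). If `S` has index
zero then at each cut as many points cross to the right as to the left. On a non-null set the
relative positions of these points are given by two fixed finite sets `L` and `R`. Over a smaller
base whose translates by small powers of `T` are disjoint, exchange `L` and `R`: this is a periodic
`P` such that `P * S` moves no point across the cuts at the base. Almost every orbit contains such
cuts arbitrarily far in both directions, so `P * S` preserves finite intervals and is periodic.

*Periodic elements lie in small closed subgroups* (`toL1_mem_of_periodic`). Given a tower of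
disjoint sets `E i '' B`, `i : ι`, finite permutations of `ι` act on it by `towerHom`. By recurrence
of `T`, any periodic element acts, off any invariant set that is not conull, on some tower as two
copies of one cyclic permutation, and two copies of a permutation form a product of commutators
(`prodCongr_mem_commutator`). Exhausting the space by such towers shows that every periodic element
is a limit of elements of the subgroup generated by the images under `towerHom` of commutator
subgroups. These images lie in the derived group; they are products of involutions, as finite
permutations are products of transpositions; and letting the base shrink to the empty set
connects them to the identity (`toL1_towerHom_mem_connectedComponent`). Hence all the groups
in question coincide with the kernel of the index (`ker_index_eq`).
-/

namespace L1Full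

noncomputable section

open Filter Topology

/-! ### Permutations that preserve every orbit -/

section

theorem zpow_add_apply {X : Type*} (T : Equiv.Perm X) (m n : ℤ) (x : X) :
    (T ^ (m + n)) x = (T ^ m) ((T ^ n) x) := by
  rw [zpow_add, Equiv.Perm.mul_apply]

variable {X : Type*} [MeasurableSpace X] {μ : Measure X}

theorem mpGroup_zpow_mp (T : mpGroup μ) (n : ℤ) : MeasurePreserving (T.1 ^ n) μ μ := by
  have := (T ^ n).2.1
  simpa using this

/-- The points whose `T`-orbit is infinite. -/
def aperiodicPart (T : mpGroup μ) : Set X := {x | ∀ n : ℤ, n ≠ 0 → (T.1 ^ n) x ≠ x}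

theorem aperiodicPart_inj {T : mpGroup μ} {x : X} (hx : x ∈ aperiodicPart T) {m n : ℤ}
    (h : (T.1 ^ m) x = (T.1 ^ n) x) : m = n := by
  by_contra hne
  refine hx (-n + m) (by omega) ?_
  rw [zpow_add_apply, h, ← zpow_add_apply]
  simp

theorem zpow_mem_aperiodicPart {T : mpGroup μ} {x : X} (k : ℤ) :
    (T.1 ^ k) x ∈ aperiodicPart T ↔ x ∈ aperiodicPart T := by
  refine forall₂_congr fun n _ => ?_
  rw [← zpow_add_apply, add_comm n k, zpow_add_apply]
  simp

theorem measurableSet_aperiodicPart [StandardBorelSpace X] (T : mpGroup μ) :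
    MeasurableSet (aperiodicPart T) := by
  simp only [aperiodicPart, Set.ofPred_forall]
  refine MeasurableSet.iInter fun n => MeasurableSet.iInter fun _ => ?_
  exact (measurableSet_eq_fun (mpGroup_zpow_measurable T n) measurable_id).compl

/-- The measurable permutations of `X` which map *every* point into its own `T`-orbit and are the
identity on the finite `T`-orbits. They represent the full group of `T` without exceptional null
sets. -/
def orbitGroup (T : mpGroup μ) : Subgroup (Equiv.Perm X) where
  carrier := {e | Measurable e ∧ Measurable e.symm ∧ (∀ x, ∃ n : ℤ, e x = (T.1 ^ n) x) ∧
    ∀ x, x ∉ aperiodicPart T → e x = x}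
  one_mem' := ⟨measurable_id, measurable_id, fun x => ⟨0, by simp⟩, fun x _ => rfl⟩
  mul_mem' := by
    rintro a b ⟨ha, ha', hao, hai⟩ ⟨hb, hb', hbo, hbi⟩
    refine ⟨ha.comp hb, hb'.comp ha', fun x => ?_, fun x hx => ?_⟩
    · obtain ⟨m, hm⟩ := hbo x
      obtain ⟨n, hn⟩ := hao (b x)
      exact ⟨n + m, by rw [Equiv.Perm.mul_apply, hn, hm, zpow_add_apply]⟩
    · rw [Equiv.Perm.mul_apply, hbi x hx, hai x hx]
  inv_mem' := by
    rintro a ⟨ha, ha', hao, hai⟩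
    refine ⟨ha', ha, fun x => ?_, fun x hx => ?_⟩
    · obtain ⟨n, hn⟩ := hao (a⁻¹ x)
      refine ⟨-n, ?_⟩
      have h2 : (T.1 ^ (-n)) (a (a⁻¹ x)) = a⁻¹ x := by
        rw [hn, ← zpow_add_apply]; simp
      rw [← h2]; simp
    · rw [Equiv.Perm.inv_eq_iff_eq, hai x hx]

/-- The cocycle of a permutation `e` that preserves the `T`-orbits: `e x = T ^ coc T e x x`, with
value `0` on the finite orbits. -/
def coc (T : mpGroup μ) (e : Equiv.Perm X) (x : X) : ℤ :=
  open Classical in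
  if x ∈ aperiodicPart T then Classical.epsilon fun n : ℤ => e x = (T.1 ^ n) x else 0

variable {T : mpGroup μ}

theorem coc_spec {e : Equiv.Perm X} (he : e ∈ orbitGroup T) (x : X) :
    e x = (T.1 ^ coc T e x) x := by
  unfold coc
  split_ifs with hx
  · exact Classical.epsilon_spec (p := fun n : ℤ => e x = (T.1 ^ n) x) (he.2.2.1 x)
  · simp [he.2.2.2 x hx]

theorem coc_eq {e : Equiv.Perm X} {x : X} (hx : x ∈ aperiodicPart T) {n : ℤ}
    (h : e x = (T.1 ^ n) x) : coc T e x = n := by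
  refine aperiodicPart_inj hx ?_
  rw [← h, coc, if_pos hx]
  exact (Classical.epsilon_spec (p := fun n : ℤ => e x = (T.1 ^ n) x) ⟨n, h⟩).symm

theorem coc_of_notMem {e : Equiv.Perm X} {x : X} (hx : x ∉ aperiodicPart T) : coc T e x = 0 :=
  if_neg hx

theorem orbitGroup_apply_mem {e : Equiv.Perm X} (he : e ∈ orbitGroup T) {x : X} :
    e x ∈ aperiodicPart T ↔ x ∈ aperiodicPart T := by
  rw [coc_spec he x, zpow_mem_aperiodicPart]

theorem coc_mul {a b : Equiv.Perm X} (ha : a ∈ orbitGroup T) (hb : b ∈ orbitGroup T) (x : X) :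
    coc T (a * b) x = coc T a (b x) + coc T b x := by
  by_cases hx : x ∈ aperiodicPart T
  · refine coc_eq hx ?_
    rw [zpow_add_apply, ← coc_spec hb x, ← coc_spec ha, Equiv.Perm.mul_apply]
  · rw [coc_of_notMem hx, coc_of_notMem hx,
      coc_of_notMem (by rwa [orbitGroup_apply_mem hb]), add_zero]

theorem coc_one (x : X) : coc T (1 : Equiv.Perm X) x = 0 := by
  by_cases hx : x ∈ aperiodicPart T
  · exact coc_eq hx (by simp)
  · exact coc_of_notMem hx

theorem coc_inv {a : Equiv.Perm X} (ha : a ∈ orbitGroup T) (x : X) :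
    coc T a⁻¹ (a x) = - coc T a x := by
  have h := coc_mul (inv_mem ha) ha x
  rw [inv_mul_cancel, coc_one] at h
  omega

theorem measurable_coc [StandardBorelSpace X] {e : Equiv.Perm X} (he : e ∈ orbitGroup T) :
    Measurable (coc T e) := by
  refine measurable_to_countable' fun n => ?_
  have : coc T e ⁻¹' {n} = (aperiodicPart T ∩ {x | e x = (T.1 ^ n) x}) ∪
      ((aperiodicPart T)ᶜ ∩ {_x | n = 0}) := by
    ext x
    by_cases hx : x ∈ aperiodicPart T
    · simp only [Set.mem_preimage, Set.mem_singleton_iff, Set.mem_union, Set.mem_inter_iff, hx,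
        Set.mem_ofPred_eq, true_and, Set.mem_compl_iff, not_true, false_and, or_false]
      exact ⟨fun h => h ▸ coc_spec he x, coc_eq hx⟩
    · simp [hx, coc_of_notMem hx, eq_comm]
  rw [this]
  exact ((measurableSet_aperiodicPart T).inter
    (measurableSet_eq_fun he.1 (mpGroup_zpow_measurable T n))).union
    ((measurableSet_aperiodicPart T).compl.inter (MeasurableSet.const _))

theorem orbitDist_zpow_of_mem {x : X} (hx : x ∈ aperiodicPart T) (n : ℤ) :
    orbitDist T.1 x ((T.1 ^ n) x) = (n.natAbs : ℝ≥0∞) := by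
  refine le_antisymm (iInf₂_le_of_le n rfl le_rfl) (le_iInf₂ fun m hm => ?_)
  rw [aperiodicPart_inj hx hm]

theorem orbitDist_apply {e : Equiv.Perm X} (he : e ∈ orbitGroup T) (x : X) :
    orbitDist T.1 x (e x) = ((coc T e x).natAbs : ℝ≥0∞) := by
  by_cases hx : x ∈ aperiodicPart T
  · conv_lhs => rw [coc_spec he x]
    exact orbitDist_zpow_of_mem hx _
  · rw [coc_of_notMem hx, he.2.2.2 x hx, orbitDist_self]; simp

/-- A measurable permutation preserving the orbits is a countable gluing of powers of `T`, hence it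
preserves the measure. -/
theorem orbitGroup_measurePreserving [StandardBorelSpace X] {e : Equiv.Perm X}
    (he : e ∈ orbitGroup T) : MeasurePreserving e μ μ := by
  refine ⟨he.1, Measure.ext fun A hA => ?_⟩
  rw [Measure.map_apply he.1 hA]
  have hc := measurable_coc he
  have hc' := measurable_coc (inv_mem he)
  have h1 : e ⁻¹' A = ⋃ n : ℤ, e ⁻¹' A ∩ coc T e ⁻¹' {n} := by ext x; simp
  have h2 : A = ⋃ n : ℤ, A ∩ coc T e⁻¹ ⁻¹' {-n} := by
    ext x
    simp only [Set.mem_iUnion, Set.mem_inter_iff, Set.mem_preimage, Set.mem_singleton_iff]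
    exact ⟨fun h => ⟨-coc T e⁻¹ x, h, by simp⟩, fun ⟨_, h, _⟩ => h⟩
  have key : ∀ n : ℤ, e ⁻¹' A ∩ coc T e ⁻¹' {n} =
      (T.1 ^ n) ⁻¹' (A ∩ coc T e⁻¹ ⁻¹' {-n}) := by
    intro n
    ext x
    simp only [Set.mem_inter_iff, Set.mem_preimage, Set.mem_singleton_iff]
    constructor
    · rintro ⟨hxA, hx⟩
      have := coc_spec he x
      rw [hx] at this
      rw [← this, coc_inv he, hx]
      exact ⟨hxA, rfl⟩
    · rintro ⟨hxA, hx⟩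
      have h := coc_spec (inv_mem he) ((T.1 ^ n) x)
      rw [hx, ← zpow_add_apply, neg_add_cancel, zpow_zero, Equiv.Perm.one_apply,
        Equiv.Perm.inv_eq_iff_eq] at h
      rw [h] at hxA hx
      rw [coc_inv he] at hx
      exact ⟨hxA, by omega⟩
  rw [h1, measure_iUnion, h2, measure_iUnion]
  · rw [← h2]
    refine tsum_congr fun n => ?_
    rw [key, (mpGroup_zpow_mp T n).measure_preimage]
    exact (hA.inter (hc' (measurableSet_singleton _))).nullMeasurableSet
  · intro m n hmn
    refine Set.disjoint_left.mpr fun x hx hx' => hmn ?_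
    have h1 := hx.2
    have h2 := hx'.2
    simp only [Set.mem_preimage, Set.mem_singleton_iff] at h1 h2
    omega
  · exact fun n => hA.inter (hc' (measurableSet_singleton _))
  · intro m n hmn
    refine Set.disjoint_left.mpr fun x hx hx' => hmn ?_
    have h1 := hx.2
    have h2 := hx'.2
    simp only [Set.mem_preimage, Set.mem_singleton_iff] at h1 h2
    omega
  · exact fun n => (he.1 hA).inter (hc (measurableSet_singleton _))

theorem orbitGroup_le_mpGroup [StandardBorelSpace X] : orbitGroup T ≤ mpGroup μ := fun _ he =>
  ⟨orbitGroup_measurePreserving he, orbitGroup_measurePreserving (inv_mem he)⟩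

/-- The elements of `orbitGroup T` with integrable displacement. -/
def intOrbitGroup [StandardBorelSpace X] (T : mpGroup μ) : Subgroup (Equiv.Perm X) where
  carrier := {e | e ∈ orbitGroup T ∧ ∫⁻ x, orbitDist T.1 x (e x) ∂μ < ⊤}
  one_mem' := ⟨one_mem _, by simp [orbitDist_self]⟩
  mul_mem' := by
    rintro a b ⟨ha, ha'⟩ ⟨hb, hb'⟩
    refine ⟨mul_mem ha hb, ?_⟩
    have hm : Measurable fun x => orbitDist T.1 x (a x) :=
      measurable_orbitDist T measurable_id ha.1
    have hm' : Measurable fun x => orbitDist T.1 x (b x) :=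
      measurable_orbitDist T measurable_id hb.1
    rw [← (orbitGroup_measurePreserving hb).lintegral_comp hm] at ha'
    refine lt_of_le_of_lt ?_ (ENNReal.add_lt_top.mpr ⟨hb', ha'⟩)
    rw [← lintegral_add_left hm']
    exact lintegral_mono fun x => orbitDist_triangle _ _ _ _
  inv_mem' := by
    rintro a ⟨ha, ha'⟩
    refine ⟨inv_mem ha, lt_of_le_of_lt (le_of_eq ?_) ha'⟩
    have hm : Measurable fun x => orbitDist T.1 x (a⁻¹ x) :=
      measurable_orbitDist T measurable_id (inv_mem ha).1
    rw [← (orbitGroup_measurePreserving ha).lintegral_comp hm]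
    exact lintegral_congr fun x => by
      rw [show a⁻¹ (a x) = x by simp, orbitDist_comm]

variable [StandardBorelSpace X]

/-- The class in `Aut μ` of a permutation preserving the orbits. -/
def toAut (T : mpGroup μ) : orbitGroup T →* Aut μ :=
  (QuotientGroup.mk' (aeTrivial μ)).comp (Subgroup.inclusion orbitGroup_le_mpGroup)

theorem rep_toAut (e : orbitGroup T) : ∀ᵐ x ∂μ, rep (toAut T e) x = e.1 x :=
  rep_mk ⟨e.1, orbitGroup_le_mpGroup e.2⟩

/-- The class in the `L¹` full group of a permutation preserving the orbits, with integrable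
displacement. -/
def toL1 (T : mpGroup μ) : intOrbitGroup T →* L1FullGroup T where
  toFun e := ⟨toAut T ⟨e.1, e.2.1⟩, by
    filter_upwards [rep_toAut (T := T) ⟨e.1, e.2.1⟩] with x hx
    rw [hx]
    exact e.2.1.2.2.1 x, by
    refine lt_of_le_of_lt (le_of_eq (lintegral_congr_ae ?_)) e.2.2
    filter_upwards [rep_toAut (T := T) ⟨e.1, e.2.1⟩] with x hx
    rw [hx]⟩
  map_one' := Subtype.ext (map_one (toAut T))
  map_mul' a b := Subtype.ext (map_mul (toAut T) ⟨a.1, a.2.1⟩ ⟨b.1, b.2.1⟩)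

theorem rep_toL1 (e : intOrbitGroup T) : ∀ᵐ x ∂μ, rep (toL1 T e).1 x = e.1 x :=
  rep_toAut (T := T) ⟨e.1, e.2.1⟩

theorem toL1_eq_iff {a b : intOrbitGroup T} :
    toL1 T a = toL1 T b ↔ ∀ᵐ x ∂μ, a.1 x = b.1 x := by
  constructor
  · intro h
    have hb := rep_toL1 b
    rw [← h] at hb
    filter_upwards [rep_toL1 a, hb] with x h1 h2
    rw [← h1, h2]
  · intro h
    refine Subtype.ext (ext_rep ?_)
    filter_upwards [rep_toL1 a, rep_toL1 b, h] with x h1 h2 h3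
    rw [h1, h2, h3]

theorem l1edist_toL1 (a b : intOrbitGroup T) :
    l1edist T (toL1 T a).1 (toL1 T b).1 = ∫⁻ x, orbitDist T.1 (a.1 x) (b.1 x) ∂μ := by
  refine lintegral_congr_ae ?_
  filter_upwards [rep_toL1 a, rep_toL1 b] with x h1 h2
  rw [h1, h2]

end

/-! ### Restriction to an invariant set, and exact representatives -/

section

variable {X : Type*} [MeasurableSpace X] {μ : Measure X}

/-- The permutation which is `e` on the `e`-invariant set `Y` and the identity elsewhere. -/
def restrictPerm {X : Type*} (e : Equiv.Perm X) (Y : Set X) (h : ∀ x, e x ∈ Y ↔ x ∈ Y) :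
    Equiv.Perm X :=
  open Classical in
  { toFun := fun x => if x ∈ Y then e x else x
    invFun := fun x => if x ∈ Y then e.symm x else x
    left_inv := fun x => by
      by_cases hx : x ∈ Y
      · simp [hx, h]
      · simp [hx]
    right_inv := fun x => by
      have h' : e.symm x ∈ Y ↔ x ∈ Y := by rw [← h, Equiv.apply_symm_apply]
      by_cases hx : x ∈ Y
      · simp [hx, h']
      · simp [hx] }

theorem restrictPerm_of_mem {X : Type*} {e : Equiv.Perm X} {Y : Set X}
    {h : ∀ x, e x ∈ Y ↔ x ∈ Y} {x : X} (hx : x ∈ Y) : restrictPerm e Y h x = e x := if_pos hx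

theorem restrictPerm_of_notMem {X : Type*} {e : Equiv.Perm X} {Y : Set X}
    {h : ∀ x, e x ∈ Y ↔ x ∈ Y} {x : X} (hx : x ∉ Y) : restrictPerm e Y h x = x := if_neg hx

theorem measurable_restrictPerm {e : Equiv.Perm X} {Y : Set X} {h : ∀ x, e x ∈ Y ↔ x ∈ Y}
    (hY : MeasurableSet Y) (he : Measurable e) : Measurable (restrictPerm e Y h) :=
  Measurable.ite hY he measurable_id

theorem measurable_restrictPerm_symm {e : Equiv.Perm X} {Y : Set X} {h : ∀ x, e x ∈ Y ↔ x ∈ Y}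
    (hY : MeasurableSet Y) (he : Measurable e.symm) : Measurable (restrictPerm e Y h).symm :=
  Measurable.ite hY he measurable_id

variable {T : mpGroup μ} [StandardBorelSpace X]

theorem restrictPerm_mem {e : Equiv.Perm X} (he : e ∈ intOrbitGroup T) {Y : Set X}
    (hY : MeasurableSet Y) (h : ∀ x, e x ∈ Y ↔ x ∈ Y) : restrictPerm e Y h ∈ intOrbitGroup T := by
  refine ⟨⟨measurable_restrictPerm hY he.1.1, measurable_restrictPerm_symm hY he.1.2.1,
    fun x => ?_, fun x hx => ?_⟩, lt_of_le_of_lt (lintegral_mono fun x => ?_) he.2⟩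
  · by_cases hx : x ∈ Y
    · rw [restrictPerm_of_mem hx]; exact he.1.2.2.1 x
    · rw [restrictPerm_of_notMem hx]; exact ⟨0, by simp⟩
  · by_cases hx' : x ∈ Y
    · rw [restrictPerm_of_mem hx']; exact he.1.2.2.2 x hx
    · rw [restrictPerm_of_notMem hx']
  · by_cases hx : x ∈ Y
    · rw [restrictPerm_of_mem hx]
    · rw [restrictPerm_of_notMem hx, orbitDist_self]; exact zero_le

/-- For an ergodic `T` on a non-atomic space almost every orbit is infinite. Otherwise some power
`T ^ n` would be the identity, and the minimum of a real coordinate over the orbits would be an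
almost everywhere constant function, so that almost all orbits pass through one point. -/
theorem ae_mem_aperiodicPart [IsProbabilityMeasure μ] [NullSingletonClass μ]
    (hT : Ergodic T.1 μ) : ∀ᵐ x ∂μ, x ∈ aperiodicPart T := by
  have key : ∀ n : ℕ, 0 < n → ∀ᵐ x ∂μ, (T.1 ^ (n : ℤ)) x ≠ x := by
    intro n hn
    have hms : MeasurableSet {x | (T.1 ^ (n : ℤ)) x = x} :=
      measurableSet_eq_fun (mpGroup_zpow_measurable T n) measurable_id
    have hinv : T.1 ⁻¹' {x | (T.1 ^ (n : ℤ)) x = x} = {x | (T.1 ^ (n : ℤ)) x = x} := by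
      ext x
      simp only [Set.mem_preimage, Set.mem_ofPred_eq]
      rw [← Equiv.Perm.mul_apply, zpow_natCast, ← pow_succ, pow_succ', Equiv.Perm.mul_apply]
      exact T.1.injective.eq_iff
    rcases hT.toPreErgodic.ae_empty_or_univ hms hinv with h0 | h1
    · have : ∀ᵐ x ∂μ, ¬ (x ∈ {x | (T.1 ^ (n : ℤ)) x = x}) := by
        filter_upwards [h0] with x hx
        intro hx'
        exact (hx.mp hx' : x ∈ (∅ : Set X))
      exact this
    exfalso
    have hper : ∀ᵐ x ∂μ, (T.1 ^ n) x = x := by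
      filter_upwards [h1] with x hx
      have : x ∈ {x | (T.1 ^ (n : ℤ)) x = x} := hx.mpr trivial
      simpa using this
    set g := embeddingReal X with hg
    have hgm : MeasurableEmbedding g := measurableEmbedding_embeddingReal X
    have hne : (Finset.range n).Nonempty := Finset.nonempty_range_iff.mpr hn.ne'
    set h : X → ℝ := fun x => (Finset.range n).inf' hne (fun i => g ((T.1 ^ i) x)) with hh
    have hhm : Measurable h := by
      have : h = (Finset.range n).inf' hne (fun i x => g ((T.1 ^ i) x)) := by
        funext x; simp [hh, Finset.inf'_apply]
      rw [this]
      refine Finset.inf'_induction hne _ (fun _ h1 _ h2 => h1.inf h2) fun i _ =>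
        hgm.measurable.comp ?_
      simpa using mpGroup_zpow_measurable T i
    have hinvh : h ∘ T.1 =ᵐ[μ] h := by
      filter_upwards [hper] with x hx
      have hle : ∀ i, i < n → h x ≤ g ((T.1 ^ i) x) := fun i hi =>
        Finset.inf'_le (f := fun i => g ((T.1 ^ i) x)) (Finset.mem_range.mpr hi)
      have hle' : ∀ i, i < n → h (T.1 x) ≤ g ((T.1 ^ i) (T.1 x)) := fun i hi =>
        Finset.inf'_le (f := fun i => g ((T.1 ^ i) (T.1 x))) (Finset.mem_range.mpr hi)
      refine le_antisymm ?_ ?_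
      · refine Finset.le_inf' hne _ fun i hi => ?_
        rcases i with _ | i
        · have := hle' (n - 1) (by omega)
          rw [← Equiv.Perm.mul_apply, ← pow_succ, Nat.sub_add_cancel hn, hx] at this
          simpa using this
        · have := hle' i (by have := Finset.mem_range.mp hi; omega)
          rwa [← Equiv.Perm.mul_apply, ← pow_succ] at this
      · refine Finset.le_inf' hne _ fun i hi => ?_
        have hi' := Finset.mem_range.mp hi
        change h x ≤ g ((T.1 ^ i) (T.1 x))
        rw [← Equiv.Perm.mul_apply, ← pow_succ]
        by_cases hin : i + 1 < n
        · exact hle _ hin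
        · have : i + 1 = n := by omega
          rw [this, hx]
          simpa using hle 0 hn
    obtain ⟨c, hc⟩ := hT.quasiErgodic.ae_eq_const_of_ae_eq_comp₀ hhm.nullMeasurable hinvh
    have hsub : (g ⁻¹' {c}).Subsingleton := fun a ha b hb =>
      hgm.injective (ha.trans hb.symm)
    have hnull : ∀ᵐ x ∂μ, x ∉ g ⁻¹' {c} := by
      exact measure_eq_zero_iff_ae_notMem.mp (hsub.measure_zero μ)
    have hall : ∀ᵐ x ∂μ, ∀ i : ℕ, (T.1 ^ i) x ∉ g ⁻¹' {c} := by
      rw [ae_all_iff]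
      intro i
      have := (mpGroup_zpow_mp T i).quasiMeasurePreserving.ae hnull
      simpa using this
    obtain ⟨x, hx1, hx2⟩ := (hall.and hc).exists
    obtain ⟨i, _, hi⟩ := Finset.exists_mem_eq_inf' hne (fun i => g ((T.1 ^ i) x))
    refine hx1 i ?_
    change g ((T.1 ^ i) x) = c
    rw [← hi]
    exact hx2
  have hall : ∀ᵐ x ∂μ, ∀ n : ℕ, 0 < n → (T.1 ^ (n : ℤ)) x ≠ x := by
    rw [ae_all_iff]
    intro n
    by_cases hn : 0 < n
    · filter_upwards [key n hn] with x hx _ using hx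
    · exact Eventually.of_forall fun x h => absurd h hn
  filter_upwards [hall] with x hx n hn heq
  refine hx n.natAbs (by omega) ?_
  rcases Int.natAbs_eq n with h | h
  · rwa [← h]
  · rw [show (n.natAbs : ℤ) = -n by omega]
    conv_lhs => rw [← heq]
    rw [← zpow_add_apply]
    simp

/-- Every class in the `L¹` full group has a representative without exceptional points: discard
the union of the `T`-orbits which meet an exceptional null set. -/
theorem toL1_surjective (hap : ∀ᵐ x ∂μ, x ∈ aperiodicPart T) :
    Function.Surjective (toL1 T) := by
  intro S
  set e : mpGroup μ := Quotient.out S.1 with he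
  have hrep : ∀ x, rep S.1 x = e.1 x := fun _ => rfl
  set good : Set X := aperiodicPart T ∩ ((⋃ n : ℤ, {x | e.1 x = (T.1 ^ n) x}) ∩
    ⋃ n : ℤ, {x | e.1.symm x = (T.1 ^ n) x}) with hgood
  have hgm : MeasurableSet good := by
    refine (measurableSet_aperiodicPart T).inter (MeasurableSet.inter ?_ ?_)
    · exact MeasurableSet.iUnion fun n =>
        measurableSet_eq_fun e.2.1.measurable (mpGroup_zpow_measurable T n)
    · exact MeasurableSet.iUnion fun n =>
        measurableSet_eq_fun e.2.2.measurable (mpGroup_zpow_measurable T n)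
  have hgae : ∀ᵐ x ∂μ, x ∈ good := by
    have h1 : ∀ᵐ x ∂μ, ∃ n : ℤ, e.1 x = (T.1 ^ n) x := S.2.1
    have h2 := e.2.2.quasiMeasurePreserving.ae h1
    filter_upwards [hap, h1, h2] with x hx h1 h2
    refine ⟨hx, Set.mem_iUnion.mpr h1, Set.mem_iUnion.mpr ?_⟩
    obtain ⟨n, hn⟩ := h2
    refine ⟨-n, ?_⟩
    rw [Equiv.apply_symm_apply] at hn
    change e.1.symm x = (T.1 ^ (-n)) x
    conv_rhs => rw [hn]
    rw [← zpow_add_apply]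
    simp
  set Y : Set X := ⋂ k : ℤ, (T.1 ^ k) ⁻¹' good with hYdef
  have hYm : MeasurableSet Y :=
    MeasurableSet.iInter fun k => mpGroup_zpow_measurable T k hgm
  have hYae : ∀ᵐ x ∂μ, x ∈ Y := by
    simp only [hYdef, Set.mem_iInter]
    rw [ae_all_iff]
    exact fun k => (mpGroup_zpow_mp T k).quasiMeasurePreserving.ae hgae
  have hYT : ∀ (k : ℤ) x, x ∈ Y → (T.1 ^ k) x ∈ Y := by
    intro k x hx
    simp only [hYdef, Set.mem_iInter] at hx ⊢
    intro j
    have := hx (j + k)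
    rwa [Set.mem_preimage, zpow_add_apply] at this
  have hYg : Y ⊆ good := fun x hx => by
    have := Set.mem_iInter.mp hx 0
    simpa using this
  have hYe : ∀ x, e.1 x ∈ Y ↔ x ∈ Y := by
    intro x
    constructor
    · intro hx
      obtain ⟨n, hn⟩ := Set.mem_iUnion.mp (hYg hx).2.2
      have hn : e.1.symm (e.1 x) = (T.1 ^ n) (e.1 x) := hn
      rw [Equiv.symm_apply_apply] at hn
      rw [hn]
      exact hYT n _ hx
    · intro hx
      obtain ⟨n, hn⟩ := Set.mem_iUnion.mp (hYg hx).2.1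
      have hn : e.1 x = (T.1 ^ n) x := hn
      rw [hn]
      exact hYT n _ hx
  have hae : ∀ᵐ x ∂μ, restrictPerm e.1 Y hYe x = e.1 x := by
    filter_upwards [hYae] with x hx using restrictPerm_of_mem hx
  have hmem : restrictPerm e.1 Y hYe ∈ intOrbitGroup T := by
    refine ⟨⟨measurable_restrictPerm hYm e.2.1.measurable,
      measurable_restrictPerm_symm hYm e.2.2.measurable, fun x => ?_, fun x hx => ?_⟩, ?_⟩
    · by_cases hx : x ∈ Y
      · rw [restrictPerm_of_mem hx]
        obtain ⟨n, hn⟩ := Set.mem_iUnion.mp (hYg hx).2.1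
        exact ⟨n, hn⟩
      · rw [restrictPerm_of_notMem hx]; exact ⟨0, by simp⟩
    · exact restrictPerm_of_notMem fun hx' => hx (hYg hx').1
    · refine lt_of_le_of_lt (le_of_eq (lintegral_congr_ae ?_)) S.2.2
      filter_upwards [hae] with x hx
      rw [hx, hrep]
  refine ⟨⟨_, hmem⟩, Subtype.ext (ext_rep ?_)⟩
  filter_upwards [hae, rep_toL1 ⟨_, hmem⟩] with x hx h
  rw [h, hx, hrep]

end

/-! ### The topology of the `L¹` full group -/

section

variable {X : Type*} [MeasurableSpace X] {μ : Measure X}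

theorem one_le_orbitDist {T : mpGroup μ} {x y : X} (h : x ≠ y) : 1 ≤ orbitDist T.1 x y := by
  refine le_iInf₂ fun n hn => ?_
  have : n ≠ 0 := by
    rintro rfl
    exact h (by simpa using hn.symm)
  exact_mod_cast Nat.one_le_iff_ne_zero.mpr (Int.natAbs_ne_zero.mpr this)

theorem setLIntegral_rep_comp (A : Aut μ) {h : X → ℝ≥0∞} (hh : Measurable h) {E : Set X}
    (hE : MeasurableSet E) :
    ∃ E' : Set X, μ E' = μ E ∧ ∫⁻ x in E, h (rep A x) ∂μ = ∫⁻ x in E', h x ∂μ := by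
  have hs : MeasurePreserving (rep A).symm μ μ := (Quotient.out A : mpGroup μ).2.2
  have hE' : MeasurableSet ((rep A).symm ⁻¹' E) := hs.measurable hE
  have hpre : rep A ⁻¹' ((rep A).symm ⁻¹' E) = E := by
    ext x; simp
  refine ⟨(rep A).symm ⁻¹' E, hs.measure_preimage hE.nullMeasurableSet, ?_⟩
  rw [← (rep_mp A).setLIntegral_comp_preimage hE' hh, hpre]

variable {T : mpGroup μ} [StandardBorelSpace X]

theorem l1edist_ne_top (A B : L1FullGroup T) : l1edist T A.1 B.1 ≠ ⊤ := by
  refine ne_top_of_le_ne_top ?_ (l1edist_triangle T A.1 1 B.1)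
  rw [l1edist_comm T A.1 1]
  exact ENNReal.add_ne_top.mpr ⟨(l1edist_one_lt_top T A).ne, (l1edist_one_lt_top T B).ne⟩

theorem L1FullGroup.dist_def (A B : L1FullGroup T) : dist A B = (l1edist T A.1 B.1).toReal := rfl

theorem L1FullGroup.edist_def (A B : L1FullGroup T) : edist A B = l1edist T A.1 B.1 := by
  rw [edist_dist, dist_def, ENNReal.ofReal_toReal (l1edist_ne_top A B)]

theorem L1FullGroup.dist_mul_right (A B C : L1FullGroup T) : dist (A * C) (B * C) = dist A B := by
  rw [dist_def, dist_def]
  exact congrArg _ (l1edist_mul_right T A.1 B.1 C.1)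

theorem measure_rep_ne_le_l1edist (A B : Aut μ) :
    μ {x | rep A x ≠ rep B x} ≤ l1edist T A B := by
  have hE : MeasurableSet {x | rep A x ≠ rep B x} :=
    (measurableSet_eq_fun (rep_mp A).measurable (rep_mp B).measurable).compl
  rw [← lintegral_indicator_one hE]
  refine lintegral_mono fun x => ?_
  by_cases hx : rep A x = rep B x
  · rw [Set.indicator_of_notMem (by simpa using hx)]; exact zero_le
  · rw [Set.indicator_of_mem (by simpa using hx)]; exact one_le_orbitDist hx

theorem L1FullGroup.continuous_mul_left (A : L1FullGroup T) :
    Continuous fun B : L1FullGroup T => A * B := by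
  rw [EMetric.continuous_iff]
  intro B ε hε
  set h : X → ℝ≥0∞ := fun y => orbitDist T.1 y (rep A.1 y) with hh
  have hm : Measurable h := measurable_orbitDist T measurable_id (rep_mp A.1).measurable
  have hε3 : ε / 3 ≠ 0 := ENNReal.div_ne_zero.mpr ⟨hε.ne', by simp⟩
  obtain ⟨δ, hδ, hδ'⟩ := exists_pos_setLIntegral_lt_of_measure_lt A.2.2.ne hε3
  refine ⟨min δ (ε / 3), lt_min hδ (pos_iff_ne_zero.mpr hε3), fun C hC => ?_⟩
  rw [edist_def] at hC ⊢
  obtain ⟨hC1, hC2⟩ := lt_min_iff.mp hC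
  set E : Set X := {x | rep C.1 x ≠ rep B.1 x} with hEdef
  have hE : MeasurableSet E :=
    (measurableSet_eq_fun (rep_mp C.1).measurable (rep_mp B.1).measurable).compl
  have hμE : μ E < δ := (measure_rep_ne_le_l1edist (T := T) C.1 B.1).trans_lt hC1
  have hint : ∀ D : Aut μ, ∫⁻ x in E, h (rep D x) ∂μ < ε / 3 := by
    intro D
    obtain ⟨E', h1, h2⟩ := setLIntegral_rep_comp D hm hE
    rw [h2]
    exact hδ' _ (h1 ▸ hμE)
  have hmd : ∀ D : Aut μ, Measurable fun x => h (rep D x) := fun D =>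
    hm.comp (rep_mp D).measurable
  have hbound : l1edist T (A * C).1 (A * B).1 ≤
      ∫⁻ x, (E.indicator (fun x => h (rep C.1 x)) x + E.indicator (fun x => h (rep B.1 x)) x)
        + orbitDist T.1 (rep C.1 x) (rep B.1 x) ∂μ := by
    refine lintegral_mono_ae ?_
    filter_upwards [rep_mul A.1 C.1, rep_mul A.1 B.1] with x h1 h2
    have h1 : rep (A * C).1 x = _ := h1
    have h2 : rep (A * B).1 x = _ := h2
    rw [h1, h2]
    by_cases hx : x ∈ E
    · rw [Set.indicator_of_mem hx, Set.indicator_of_mem hx]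
      calc orbitDist T.1 (rep A.1 (rep C.1 x)) (rep A.1 (rep B.1 x))
          ≤ orbitDist T.1 (rep A.1 (rep C.1 x)) (rep C.1 x)
            + orbitDist T.1 (rep C.1 x) (rep A.1 (rep B.1 x)) := orbitDist_triangle _ _ _ _
        _ ≤ orbitDist T.1 (rep A.1 (rep C.1 x)) (rep C.1 x)
            + (orbitDist T.1 (rep C.1 x) (rep B.1 x)
              + orbitDist T.1 (rep B.1 x) (rep A.1 (rep B.1 x))) := by
            gcongr; exact orbitDist_triangle _ _ _ _
        _ = _ := by
            rw [orbitDist_comm T.1 (rep A.1 (rep C.1 x))]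
            simp only [hh]
            ring
    · have : rep C.1 x = rep B.1 x := by simpa [hEdef] using hx
      rw [this, orbitDist_self]
      exact zero_le
  refine hbound.trans_lt ?_
  rw [lintegral_add_right _ (measurable_rep_dist T C.1 B.1),
    lintegral_add_left ((hmd C.1).indicator hE), lintegral_indicator hE, lintegral_indicator hE]
  calc _ < ε / 3 + ε / 3 + ε / 3 :=
        ENNReal.add_lt_add (ENNReal.add_lt_add (hint _) (hint _)) hC2
    _ = ε := ENNReal.add_thirds ε

instance L1FullGroup.instIsTopologicalGroup : IsTopologicalGroup (L1FullGroup T) where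
  continuous_mul := by
    rw [continuous_iff_continuousAt]
    rintro ⟨A, B⟩
    refine tendsto_iff_dist_tendsto_zero.mpr ?_
    have h1 : Tendsto (fun p : L1FullGroup T × L1FullGroup T =>
        dist p.1 A + dist (A * p.2) (A * B)) (𝓝 (A, B)) (𝓝 0) := by
      have h : Continuous fun p : L1FullGroup T × L1FullGroup T =>
          dist p.1 A + dist (A * p.2) (A * B) :=
        (continuous_fst.dist continuous_const).add
          (((L1FullGroup.continuous_mul_left A).comp continuous_snd).dist continuous_const)
      have := h.tendsto (A, B)
      simpa using this
    refine squeeze_zero (fun _ => dist_nonneg) (fun p => ?_) h1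
    calc dist (p.1 * p.2) (A * B) ≤ dist (p.1 * p.2) (A * p.2) + dist (A * p.2) (A * B) :=
          dist_triangle _ _ _
      _ = _ := by rw [L1FullGroup.dist_mul_right]
  continuous_inv := by
    rw [continuous_iff_continuousAt]
    intro A
    refine tendsto_iff_dist_tendsto_zero.mpr ?_
    have h : Continuous fun B : L1FullGroup T => dist 1 (A⁻¹ * B) :=
      continuous_const.dist (L1FullGroup.continuous_mul_left A⁻¹)
    have := h.tendsto A
    rw [inv_mul_cancel, dist_self] at this
    refine this.congr fun B => ?_
    rw [← L1FullGroup.dist_mul_right B⁻¹ A⁻¹ B, inv_mul_cancel]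

/-- Dominated convergence in the `L¹` full group. -/
theorem tendsto_toL1 {ι : Type*} {l : Filter ι} [l.IsCountablyGenerated]
    {a : ι → intOrbitGroup T} {b : intOrbitGroup T} {h : X → ℝ≥0∞} (hh : ∫⁻ x, h x ∂μ ≠ ⊤)
    (hle : ∀ i x, orbitDist T.1 ((a i).1 x) (b.1 x) ≤ h x)
    (hev : ∀ᵐ x ∂μ, ∀ᶠ i in l, (a i).1 x = b.1 x) :
    Tendsto (fun i => toL1 T (a i)) l (𝓝 (toL1 T b)) := by
  refine tendsto_iff_edist_tendsto_0.mpr ?_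
  simp only [L1FullGroup.edist_def, l1edist_toL1]
  rw [← lintegral_zero (μ := μ)]
  refine tendsto_lintegral_filter_of_dominated_convergence h
    (Eventually.of_forall fun i => measurable_orbitDist T (a i).2.1.1 b.2.1.1)
    (Eventually.of_forall fun i => Eventually.of_forall (hle i)) hh ?_
  filter_upwards [hev] with x hx
  refine tendsto_const_nhds.congr' ?_
  filter_upwards [hx] with i hi
  rw [hi, orbitDist_self]

end

/-! ### The index is a flux -/

section

variable {X : Type*} [MeasurableSpace X] {μ : Measure X}

/-- The contribution of a point at `m ∈ ℤ`, displaced by `c`, to the flux through the cut between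
`-1` and `0`: `1` if it crosses the cut to the right, `-1` if it crosses to the left. -/
def crossing (c m : ℤ) : ℤ := (if m < 0 then 1 else 0) - (if m + c < 0 then 1 else 0)

theorem crossing_of_nonneg {c : ℤ} (hc : 0 ≤ c) (m : ℤ) :
    crossing c m = if m ∈ Finset.Ico (-c) 0 then 1 else 0 := by
  unfold crossing
  simp only [Finset.mem_Ico]
  split_ifs <;> omega

theorem crossing_of_nonpos {c : ℤ} (hc : c ≤ 0) (m : ℤ) :
    crossing c m = if m ∈ Finset.Ico 0 (-c) then -1 else 0 := by
  unfold crossing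
  simp only [Finset.mem_Ico]
  split_ifs <;> omega

theorem crossing_sub_one (c m : ℤ) : crossing c (m - 1) =
    crossing c m + (if m = 0 then 1 else 0) - (if m + c = 0 then 1 else 0) := by
  unfold crossing
  split_ifs <;> omega

theorem tsum_crossing (c : ℤ) : ∑' m, (crossing c m : ℝ) = c := by
  rcases le_total 0 c with hc | hc
  · rw [tsum_eq_sum (s := Finset.Ico (-c) 0)]
    · rw [Finset.sum_congr rfl (g := fun _ => (1 : ℝ))]
      · simp only [Finset.sum_const, Int.card_Ico, nsmul_eq_mul, mul_one]
        rw [← Int.cast_natCast]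
        congr 1
        omega
      · intro m hm
        rw [crossing_of_nonneg hc, if_pos hm, Int.cast_one]
    · intro m hm
      rw [crossing_of_nonneg hc, if_neg hm, Int.cast_zero]
  · rw [tsum_eq_sum (s := Finset.Ico 0 (-c))]
    · rw [Finset.sum_congr rfl (g := fun _ => (-1 : ℝ))]
      · simp only [Finset.sum_const, Int.card_Ico, nsmul_eq_mul]
        rw [← Int.cast_natCast, Int.toNat_of_nonneg (by omega)]
        push_cast
        ring
      · intro m hm
        rw [crossing_of_nonpos hc, if_pos hm, Int.cast_neg, Int.cast_one]
    · intro m hm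
      rw [crossing_of_nonpos hc, if_neg hm, Int.cast_zero]

theorem enorm_intCast (n : ℤ) : ‖(n : ℝ)‖ₑ = (n.natAbs : ℝ≥0∞) := by
  rw [← ofReal_norm, Real.norm_eq_abs, ← Int.cast_abs, Int.abs_eq_natAbs,
    Int.cast_natCast, ENNReal.ofReal_natCast]

theorem tsum_enorm_crossing (c : ℤ) : ∑' m, ‖(crossing c m : ℝ)‖ₑ = (c.natAbs : ℝ≥0∞) := by
  simp only [enorm_intCast]
  rcases le_total 0 c with hc | hc
  · rw [tsum_eq_sum (s := Finset.Ico (-c) 0)]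
    · rw [Finset.sum_congr rfl (g := fun _ => (1 : ℝ≥0∞))]
      · simp only [Finset.sum_const, Int.card_Ico, nsmul_eq_mul, mul_one]
        congr 1
        omega
      · intro m hm
        rw [crossing_of_nonneg hc, if_pos hm]; simp
    · intro m hm
      rw [crossing_of_nonneg hc, if_neg hm]; simp
  · rw [tsum_eq_sum (s := Finset.Ico 0 (-c))]
    · rw [Finset.sum_congr rfl (g := fun _ => (1 : ℝ≥0∞))]
      · simp only [Finset.sum_const, Int.card_Ico, nsmul_eq_mul, mul_one]
        congr 1
        omega
      · intro m hm
        rw [crossing_of_nonpos hc, if_pos hm]; simp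
    · intro m hm
      rw [crossing_of_nonpos hc, if_neg hm]; simp

/-- The permutation of `ℤ` by which `e` acts on the orbit of `x`, parametrized by `m ↦ T ^ m x`. -/
def linePerm {T : mpGroup μ} {e : Equiv.Perm X} (he : e ∈ orbitGroup T) (x : X) :
    Equiv.Perm ℤ where
  toFun m := m + coc T e ((T.1 ^ m) x)
  invFun m := m + coc T e⁻¹ ((T.1 ^ m) x)
  left_inv m := by
    have h : (T.1 ^ (m + coc T e ((T.1 ^ m) x))) x = e ((T.1 ^ m) x) := by
      rw [add_comm, zpow_add_apply, ← coc_spec he]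
    simp only [h, coc_inv he]
    ring
  right_inv m := by
    have h : (T.1 ^ (m + coc T e⁻¹ ((T.1 ^ m) x))) x = e⁻¹ ((T.1 ^ m) x) := by
      rw [add_comm, zpow_add_apply, ← coc_spec (inv_mem he)]
    have h2 := coc_inv (inv_mem he) ((T.1 ^ m) x)
    rw [inv_inv] at h2
    simp only [h, h2]
    ring

variable {T : mpGroup μ}

theorem linePerm_apply {e : Equiv.Perm X} (he : e ∈ orbitGroup T) (x : X) (m : ℤ) :
    linePerm he x m = m + coc T e ((T.1 ^ m) x) := rfl

theorem zpow_linePerm {e : Equiv.Perm X} (he : e ∈ orbitGroup T) (x : X) (m : ℤ) :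
    (T.1 ^ linePerm he x m) x = e ((T.1 ^ m) x) := by
  rw [linePerm_apply, add_comm, zpow_add_apply, ← coc_spec he]

theorem linePerm_mul {a b : Equiv.Perm X} (ha : a ∈ orbitGroup T) (hb : b ∈ orbitGroup T)
    (x : X) : linePerm (mul_mem ha hb) x = linePerm ha x * linePerm hb x := by
  ext m
  rw [Equiv.Perm.mul_apply, linePerm_apply, linePerm_apply ha, zpow_linePerm, linePerm_apply,
    coc_mul ha hb]
  ring

variable [StandardBorelSpace X]

theorem integrable_coc (e : intOrbitGroup T) : Integrable (fun x => (coc T e.1 x : ℝ)) μ := by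
  refine ⟨(measurable_from_top.comp (measurable_coc e.2.1)).aestronglyMeasurable, ?_⟩
  refine lt_of_le_of_lt (le_of_eq (lintegral_congr fun x => ?_)) e.2.2
  rw [enorm_intCast, orbitDist_apply e.2.1]

theorem cocycle_toL1 (hap : ∀ᵐ x ∂μ, x ∈ aperiodicPart T) (e : intOrbitGroup T) :
    ∀ᵐ x ∂μ, cocycle T (toL1 T e).1 x = coc T e.1 x := by
  filter_upwards [hap, rep_toL1 e] with x hx h
  refine aperiodicPart_inj hx ?_
  rw [← coc_spec e.2.1, ← h]
  exact (Classical.epsilon_spec (p := fun n : ℤ => rep (toL1 T e).1 x = (T.1 ^ n) x)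
    ⟨_, h.trans (coc_spec e.2.1 x)⟩).symm

theorem index_toL1 (hap : ∀ᵐ x ∂μ, x ∈ aperiodicPart T) (e : intOrbitGroup T) :
    index T (toL1 T e) = ∫ x, (coc T e.1 x : ℝ) ∂μ := by
  refine integral_congr_ae ?_
  filter_upwards [cocycle_toL1 hap e] with x hx
  rw [hx]

theorem integral_coc_mul (a b : intOrbitGroup T) :
    ∫ x, (coc T (a * b).1 x : ℝ) ∂μ = ∫ x, (coc T a.1 x : ℝ) ∂μ + ∫ x, (coc T b.1 x : ℝ) ∂μ := by
  have hmp := orbitGroup_measurePreserving b.2.1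
  have hemb : MeasurableEmbedding b.1 :=
    (MeasurableEquiv.mk b.1 b.2.1.1 b.2.1.2.1).measurableEmbedding
  have h1 : Integrable (fun x => (coc T a.1 (b.1 x) : ℝ)) μ :=
    hmp.integrable_comp_of_integrable (integrable_coc a)
  rw [← hmp.integral_comp hemb (fun x => (coc T a.1 x : ℝ)), ← integral_add h1 (integrable_coc b)]
  refine integral_congr_ae (Eventually.of_forall fun x => ?_)
  change (coc T (a.1 * b.1) x : ℝ) = _
  rw [coc_mul a.2.1 b.2.1]
  push_cast
  ring

/-- Along almost every orbit only finitely many points cross a given cut, and the flux through the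
cut, which does not depend on the cut, is the integral of the cocycle: both quantities have the
integral `∑ m, μ (crossings from m)`, and the flux is constant by ergodicity. -/
theorem hasSum_crossing [IsProbabilityMeasure μ] (hT : Ergodic T.1 μ) (e : intOrbitGroup T) :
    ∀ᵐ x ∂μ, {m : ℤ | crossing (coc T e.1 ((T.1 ^ m) x)) m ≠ 0}.Finite ∧
      HasSum (fun m : ℤ => (crossing (coc T e.1 ((T.1 ^ m) x)) m : ℝ))
        (∫ x, (coc T e.1 x : ℝ) ∂μ) := by
  set c : X → ℤ := coc T e.1 with hc
  have hcm : Measurable c := measurable_coc e.2.1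
  set G : ℤ → X → ℝ := fun m x => (crossing (c x) m : ℝ) with hG
  set F : ℤ → X → ℝ := fun m x => (crossing (c ((T.1 ^ m) x)) m : ℝ) with hF
  have hGm : ∀ m, Measurable (G m) := fun m =>
    (measurable_from_top (f := fun k : ℤ => (crossing k m : ℝ))).comp hcm
  have hTm := fun m : ℤ => mpGroup_zpow_mp T m
  have hFm : ∀ m, Measurable (F m) := fun m => (hGm m).comp (hTm m).measurable
  have hemb : ∀ m : ℤ, MeasurableEmbedding (T.1 ^ m) := fun m =>
    (MeasurableEquiv.mk (T.1 ^ m) (hTm m).measurable (by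
      have := mpGroup_zpow_measurable T (-m)
      rwa [zpow_neg] at this)).measurableEmbedding
  have hGe : ∑' m, ∫⁻ x, ‖G m x‖ₑ ∂μ ≠ ⊤ := by
    rw [← lintegral_tsum fun m => (hGm m).enorm.aemeasurable]
    simp only [hG, tsum_enorm_crossing]
    refine (lt_of_le_of_lt (le_of_eq (lintegral_congr fun x => ?_)) e.2.2).ne
    rw [orbitDist_apply e.2.1]
  have hFG : ∀ m, ∫⁻ x, ‖F m x‖ₑ ∂μ = ∫⁻ x, ‖G m x‖ₑ ∂μ := fun m =>
    (hTm m).lintegral_comp (hGm m).enorm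
  have hFe : ∑' m, ∫⁻ x, ‖F m x‖ₑ ∂μ ≠ ⊤ := by simpa only [hFG] using hGe
  have hint : ∫ x, ∑' m, F m x ∂μ = ∫ x, (c x : ℝ) ∂μ := by
    rw [integral_tsum (fun m => (hFm m).aestronglyMeasurable) hFe]
    rw [integral_congr_ae (Eventually.of_forall fun x => (tsum_crossing (c x)).symm),
      integral_tsum (fun m => (hGm m).aestronglyMeasurable) hGe]
    exact tsum_congr fun m => (hTm m).integral_comp (hemb m) (G m)
  have hfin : ∀ᵐ x ∂μ, {m : ℤ | crossing (c ((T.1 ^ m) x)) m ≠ 0}.Finite := by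
    rw [← lintegral_tsum fun m => (hFm m).enorm.aemeasurable] at hFe
    have hmeas : Measurable fun x => ∑' m, ‖F m x‖ₑ := Measurable.tsum fun m => (hFm m).enorm
    filter_upwards [ae_lt_top hmeas hFe] with x hx
    refine (ENNReal.finite_const_le_of_tsum_ne_top hx.ne one_ne_zero).subset fun m hm => ?_
    change 1 ≤ ‖F m x‖ₑ
    rw [hF, enorm_intCast]
    exact_mod_cast Nat.one_le_iff_ne_zero.mpr (Int.natAbs_ne_zero.mpr hm)
  have hsum : ∀ᵐ x ∂μ, HasSum (fun m => F m x) (∑' m, F m x) := by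
    filter_upwards [hfin] with x hx
    refine (summable_of_hasFiniteSupport (hx.subset fun m hm => ?_)).hasSum
    intro h0
    exact hm (by simp only [hF, h0, Int.cast_zero])
  -- moving the cut by one step removes the point `0` and its preimage from the count
  have hshift : ∀ᵐ x ∂μ, ∑' m, F m (T.1 x) = ∑' m, F m x := by
    filter_upwards [hsum] with x hx
    refine HasSum.tsum_eq ?_
    rw [← (Equiv.addRight (-1 : ℤ)).hasSum_iff]
    have h1 : HasSum (fun m : ℤ => if m = 0 then (1 : ℝ) else 0) 1 := hasSum_ite_eq 0 1
    have h2 := (linePerm e.2.1 x).hasSum_iff.mpr h1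
    have h3 := (hx.add h1).sub h2
    rw [add_sub_cancel_right] at h3
    refine (congrArg (fun f => HasSum f _) (funext fun m => ?_)).mpr h3
    have h4 : (T.1 ^ (m + -1)) (T.1 x) = (T.1 ^ m) x := by
      rw [zpow_add_apply]; simp
    simp only [hF, Function.comp_apply, Equiv.coe_addRight, h4]
    have h5 := crossing_sub_one (c ((T.1 ^ m) x)) m
    rw [linePerm_apply, ← sub_eq_add_neg m 1, h5]
    push_cast
    congr 2
  have hmeas : AEMeasurable (fun x => ∑' m, F m x) μ :=
    (Measurable.tsum hFm).aemeasurable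
  obtain ⟨k, hk⟩ := hT.ae_eq_const_of_ae_eq_comp_ae (g := fun x => ∑' m, F m x)
    hmeas.aestronglyMeasurable hshift
  have hk' : k = ∫ x, (c x : ℝ) ∂μ := by
    rw [← hint, integral_congr_ae hk]
    simp
  filter_upwards [hfin, hsum, hk] with x h1 h2 h3
  refine ⟨h1, ?_⟩
  rw [← hk']
  have h3 : ∑' m, F m x = k := h3
  rwa [h3] at h2

end

/-! ### Finite permutations acting on towers -/

section

variable {X : Type*} [MeasurableSpace X] {μ : Measure X}

/-- The sets `E i '' B`, for `i : ι`, are pairwise disjoint: they are the levels of a tower over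
the base `B`. -/
def IsTower {X ι : Type*} (E : ι → Equiv.Perm X) (B : Set X) : Prop :=
  ∀ ⦃x⦄, x ∈ B → ∀ ⦃y⦄, y ∈ B → ∀ ⦃i j⦄, E i x = E j y → i = j

theorem IsTower.mono {X ι : Type*} {E : ι → Equiv.Perm X} {B B' : Set X} (h : IsTower E B)
    (hB : B' ⊆ B) : IsTower E B' := fun _ hx _ hy _ _ hij => h (hB hx) (hB hy) hij

/-- The map that permutes the levels of a tower by `σ` and fixes all points outside it. -/
def towerMap {X ι : Type*} (E : ι → Equiv.Perm X) (B : Set X) (σ : Equiv.Perm ι) (z : X) : X :=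
  open Classical in
  if h : ∃ i, (E i)⁻¹ z ∈ B then E (σ h.choose) ((E h.choose)⁻¹ z) else z

theorem towerMap_of_notMem {X ι : Type*} {E : ι → Equiv.Perm X} {B : Set X} (σ : Equiv.Perm ι)
    {z : X} (h : ∀ i, (E i)⁻¹ z ∉ B) : towerMap E B σ z = z :=
  dif_neg (by simpa using h)

theorem IsTower.towerMap_apply' {X ι : Type*} {E : ι → Equiv.Perm X} {B : Set X}
    (hE : IsTower E B) (σ : Equiv.Perm ι) {i : ι} {z : X} (h : (E i)⁻¹ z ∈ B) :
    towerMap E B σ z = E (σ i) ((E i)⁻¹ z) := by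
  have h' : ∃ i, (E i)⁻¹ z ∈ B := ⟨i, h⟩
  have : h'.choose = i := hE h'.choose_spec h (by simp)
  rw [towerMap, dif_pos h', this]

theorem IsTower.towerMap_apply {X ι : Type*} {E : ι → Equiv.Perm X} {B : Set X}
    (hE : IsTower E B) (σ : Equiv.Perm ι) (i : ι) {x : X} (h : x ∈ B) :
    towerMap E B σ (E i x) = E (σ i) x := by
  rw [hE.towerMap_apply' σ (i := i) (by simpa using h)]
  simp

theorem IsTower.towerMap_mul {X ι : Type*} {E : ι → Equiv.Perm X} {B : Set X}
    (hE : IsTower E B) (σ ρ : Equiv.Perm ι) (z : X) :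
    towerMap E B σ (towerMap E B ρ z) = towerMap E B (σ * ρ) z := by
  by_cases h : ∃ i, (E i)⁻¹ z ∈ B
  · obtain ⟨i, hi⟩ := h
    rw [hE.towerMap_apply' ρ hi, hE.towerMap_apply σ _ hi, hE.towerMap_apply' _ hi,
      Equiv.Perm.mul_apply]
  · push Not at h
    rw [towerMap_of_notMem ρ h, towerMap_of_notMem σ h, towerMap_of_notMem _ h]

theorem IsTower.towerMap_one {X ι : Type*} {E : ι → Equiv.Perm X} {B : Set X}
    (hE : IsTower E B) (z : X) : towerMap E B 1 z = z := by
  by_cases h : ∃ i, (E i)⁻¹ z ∈ B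
  · obtain ⟨i, hi⟩ := h
    rw [hE.towerMap_apply' 1 hi]; simp
  · push Not at h
    rw [towerMap_of_notMem 1 h]

theorem towerMap_congr {X ι : Type*} {E : ι → Equiv.Perm X} {B B' : Set X}
    (hE : IsTower E B) (hE' : IsTower E B') (σ : Equiv.Perm ι) {z : X}
    (h : ∀ i, (E i)⁻¹ z ∈ B ↔ (E i)⁻¹ z ∈ B') : towerMap E B σ z = towerMap E B' σ z := by
  by_cases h0 : ∃ i, (E i)⁻¹ z ∈ B
  · obtain ⟨i, hi⟩ := h0
    rw [hE.towerMap_apply' σ hi, hE'.towerMap_apply' σ ((h i).mp hi)]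
  · push Not at h0
    rw [towerMap_of_notMem σ h0, towerMap_of_notMem σ fun i hi => h0 i ((h i).mpr hi)]

/-- The permutation given by `towerMap`. -/
def IsTower.perm {X ι : Type*} {E : ι → Equiv.Perm X} {B : Set X} (hE : IsTower E B)
    (σ : Equiv.Perm ι) : Equiv.Perm X where
  toFun := towerMap E B σ
  invFun := towerMap E B σ⁻¹
  left_inv z := by rw [hE.towerMap_mul, inv_mul_cancel, hE.towerMap_one]
  right_inv z := by rw [hE.towerMap_mul, mul_inv_cancel, hE.towerMap_one]

variable {T : mpGroup μ} [StandardBorelSpace X] {ι : Type*}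

/-- A bound for the displacement of `towerMap E B σ`, independent of `B` and `σ`. -/
def towerBound (E : ι → intOrbitGroup T) (z : X) : ℝ≥0∞ :=
  ∑' p : ι × ι, orbitDist T.1 z ((E p.1 * (E p.2)⁻¹).1 z)

theorem orbitDist_towerMap_le {E : ι → intOrbitGroup T} {B : Set X}
    (hE : IsTower (fun i => (E i).1) B) (σ : Equiv.Perm ι) (z : X) :
    orbitDist T.1 z (towerMap (fun i => (E i).1) B σ z) ≤ towerBound E z := by
  by_cases h : ∃ i, (E i).1⁻¹ z ∈ B
  · obtain ⟨i, hi⟩ := h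
    rw [hE.towerMap_apply' σ hi]
    exact ENNReal.le_tsum (f := fun p : ι × ι => orbitDist T.1 z ((E p.1 * (E p.2)⁻¹).1 z))
      (σ i, i)
  · push Not at h
    rw [towerMap_of_notMem σ h, orbitDist_self]
    exact zero_le

variable [Finite ι]

theorem measurable_towerMap {E : ι → intOrbitGroup T} {B : Set X} (hB : MeasurableSet B)
    (hE : IsTower (fun i => (E i).1) B) (σ : Equiv.Perm ι) :
    Measurable (towerMap (fun i => (E i).1) B σ) := by
  intro A hA
  have hinv : ∀ i, Measurable ⇑((E i).1⁻¹) := fun i => (inv_mem (E i).2.1).1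
  have : towerMap (fun i => (E i).1) B σ ⁻¹' A =
      (A ∩ ⋂ i, (⇑((E i).1⁻¹) ⁻¹' B)ᶜ) ∪ ⋃ i, ⇑((E i).1⁻¹) ⁻¹' (B ∩ (E (σ i)).1 ⁻¹' A) := by
    ext z
    simp only [Set.mem_preimage, Set.mem_union, Set.mem_inter_iff, Set.mem_iInter,
      Set.mem_compl_iff, Set.mem_iUnion]
    by_cases h : ∃ i, (E i).1⁻¹ z ∈ B
    · obtain ⟨i, hi⟩ := h
      rw [hE.towerMap_apply' σ hi]
      constructor
      · exact fun hz => Or.inr ⟨i, hi, hz⟩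
      · rintro (⟨_, h⟩ | ⟨j, hj, hz⟩)
        · exact absurd hi (h i)
        · have : i = j := hE hi hj (by simp)
          subst this
          exact hz
    · push Not at h
      rw [towerMap_of_notMem σ h]
      constructor
      · exact fun hz => Or.inl ⟨hz, h⟩
      · rintro (⟨hz, _⟩ | ⟨j, hj, _⟩)
        · exact hz
        · exact absurd hj (h j)
  rw [this]
  exact (hA.inter (MeasurableSet.iInter fun i => (hinv i hB).compl)).union
    (MeasurableSet.iUnion fun i => hinv i (hB.inter ((E (σ i)).2.1.1 hA)))

theorem lintegral_towerBound (E : ι → intOrbitGroup T) : ∫⁻ z, towerBound E z ∂μ < ⊤ := by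
  have := Fintype.ofFinite ι
  simp only [towerBound, tsum_fintype]
  rw [lintegral_finsetSum]
  · exact ENNReal.sum_lt_top.mpr fun p _ => (E p.1 * (E p.2)⁻¹).2.2
  · exact fun p _ => measurable_orbitDist T measurable_id (E p.1 * (E p.2)⁻¹).2.1.1

theorem IsTower.perm_mem {E : ι → intOrbitGroup T} {B : Set X} (hB : MeasurableSet B)
    (hE : IsTower (fun i => (E i).1) B) (σ : Equiv.Perm ι) : hE.perm σ ∈ intOrbitGroup T := by
  refine ⟨⟨measurable_towerMap hB hE σ, measurable_towerMap hB hE σ⁻¹, fun z => ?_, fun z hz => ?_⟩,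
    lt_of_le_of_lt (lintegral_mono fun z => orbitDist_towerMap_le hE σ z)
      (lintegral_towerBound E)⟩
  · change ∃ n, towerMap _ B σ z = _
    by_cases h : ∃ i, (E i).1⁻¹ z ∈ B
    · obtain ⟨i, hi⟩ := h
      rw [hE.towerMap_apply' σ hi]
      exact (E (σ i) * (E i)⁻¹).2.1.2.2.1 z
    · push Not at h
      exact ⟨0, by rw [towerMap_of_notMem σ h]; simp⟩
  · change towerMap _ B σ z = z
    by_cases h : ∃ i, (E i).1⁻¹ z ∈ B
    · obtain ⟨i, hi⟩ := h
      rw [hE.towerMap_apply' σ hi]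
      exact (E (σ i) * (E i)⁻¹).2.1.2.2.2 z hz
    · push Not at h
      rw [towerMap_of_notMem σ h]

/-- The action of the permutations of the levels of a tower. -/
def towerHom (E : ι → intOrbitGroup T) (B : Set X) (hB : MeasurableSet B)
    (hE : IsTower (fun i => (E i).1) B) : Equiv.Perm ι →* intOrbitGroup T where
  toFun σ := ⟨hE.perm σ, hE.perm_mem hB σ⟩
  map_one' := Subtype.ext (Equiv.ext fun z => hE.towerMap_one z)
  map_mul' σ ρ := Subtype.ext (Equiv.ext fun z => (hE.towerMap_mul σ ρ z).symm)

theorem towerHom_apply (E : ι → intOrbitGroup T) (B : Set X) (hB : MeasurableSet B)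
    (hE : IsTower (fun i => (E i).1) B) (σ : Equiv.Perm ι) (z : X) :
    (towerHom E B hB hE σ).1 z = towerMap (fun i => (E i).1) B σ z := rfl

theorem tendsto_towerHom {E : ι → intOrbitGroup T} {κ : Type*} {l : Filter κ}
    [l.IsCountablyGenerated] {B : κ → Set X} (hB : ∀ k, MeasurableSet (B k))
    (hE : ∀ k, IsTower (fun i => (E i).1) (B k)) {B' : Set X} (hB' : MeasurableSet B')
    (hE' : IsTower (fun i => (E i).1) B') (σ : Equiv.Perm ι)
    (h : ∀ᵐ z ∂μ, ∀ i, ∀ᶠ k in l, ((E i).1⁻¹ z ∈ B k ↔ (E i).1⁻¹ z ∈ B')) :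
    Tendsto (fun k => toL1 T (towerHom E (B k) (hB k) (hE k) σ)) l
      (𝓝 (toL1 T (towerHom E B' hB' hE' σ))) := by
  refine tendsto_toL1 (h := fun z => towerBound E z + towerBound E z) ?_ (fun k z => ?_) ?_
  · rw [lintegral_add_left']
    · exact ENNReal.add_ne_top.mpr ⟨(lintegral_towerBound E).ne, (lintegral_towerBound E).ne⟩
    · exact (Measurable.tsum fun p : ι × ι =>
        measurable_orbitDist T measurable_id (E p.1 * (E p.2)⁻¹).2.1.1).aemeasurable
  · refine (orbitDist_triangle _ _ z _).trans (add_le_add ?_ ?_)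
    · rw [orbitDist_comm]
      exact orbitDist_towerMap_le (hE k) σ z
    · exact orbitDist_towerMap_le hE' σ z
  · filter_upwards [h] with z hz
    filter_upwards [eventually_all.mpr hz] with k hk
    exact towerMap_congr (hE k) hE' σ hk

/-- Letting the base of the tower grow from the empty set yields a path from the identity to a
permutation of the levels of the tower. -/
theorem toL1_towerHom_mem_connectedComponent [NullSingletonClass μ] (E : ι → intOrbitGroup T)
    (B : Set X) (hB : MeasurableSet B) (hE : IsTower (fun i => (E i).1) B) (σ : Equiv.Perm ι) :
    toL1 T (towerHom E B hB hE σ) ∈ connectedComponent (1 : L1FullGroup T) := by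
  set g := embeddingReal X
  have hg : MeasurableEmbedding g := measurableEmbedding_embeddingReal X
  set Bt : ℝ → Set X := fun t => B ∩ g ⁻¹' Set.Iic t with hBt
  have hm : ∀ t, MeasurableSet (Bt t) := fun t => hB.inter (hg.measurable measurableSet_Iic)
  have htow : ∀ t, IsTower (fun i => (E i).1) (Bt t) := fun t => hE.mono Set.inter_subset_left
  set γ : ℝ → L1FullGroup T := fun t => toL1 T (towerHom E (Bt t) (hm t) (htow t) σ) with hγ
  have hcont : Continuous γ := by
    rw [continuous_iff_continuousAt]
    intro t
    refine tendsto_towerHom hm htow (hm t) (htow t) σ ?_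
    have hnull : ∀ᵐ x ∂μ, g x ≠ t := by
      have hsub : (g ⁻¹' {t}).Subsingleton := fun a ha b hb =>
        hg.injective (ha.trans hb.symm)
      exact measure_eq_zero_iff_ae_notMem.mp (hsub.measure_zero μ)
    rw [ae_all_iff]
    intro i
    have h1 : ∀ᵐ z ∂μ, g ((E i).1⁻¹ z) ≠ t :=
      (orbitGroup_measurePreserving (inv_mem (E i).2.1)).quasiMeasurePreserving.ae hnull
    filter_upwards [h1] with z hz
    rcases lt_or_gt_of_ne hz with h | h
    · filter_upwards [Ioi_mem_nhds h] with s hs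
      simp only [hBt, Set.mem_inter_iff, Set.mem_preimage, Set.mem_Iic, h.le,
        (Set.mem_Ioi.mp hs).le]
    · filter_upwards [Iio_mem_nhds h] with s hs
      simp only [hBt, Set.mem_inter_iff, Set.mem_preimage, Set.mem_Iic, not_le.mpr h,
        not_le.mpr (Set.mem_Iio.mp hs)]
  have htop : Tendsto γ atTop (𝓝 (toL1 T (towerHom E B hB hE σ))) := by
    refine tendsto_towerHom hm htow hB hE σ (Eventually.of_forall fun z i => ?_)
    filter_upwards [eventually_ge_atTop (g ((E i).1⁻¹ z))] with s hs
    simp only [hBt, Set.mem_inter_iff, Set.mem_preimage, Set.mem_Iic, hs, and_true]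
  have hbot : Tendsto γ atBot (𝓝 1) := by
    have hE0 : IsTower (fun i => (E i).1) (∅ : Set X) := hE.mono (Set.empty_subset _)
    have h1 : toL1 T (towerHom E ∅ MeasurableSet.empty hE0 σ) = 1 := by
      rw [← map_one (toL1 T)]
      refine toL1_eq_iff.mpr (Eventually.of_forall fun z => ?_)
      exact towerMap_of_notMem σ fun i => Set.notMem_empty _
    rw [← h1]
    refine tendsto_towerHom hm htow _ _ σ (Eventually.of_forall fun z i => ?_)
    filter_upwards [eventually_lt_atBot (g ((E i).1⁻¹ z))] with s hs
    simp only [hBt, Set.mem_inter_iff, Set.mem_preimage, Set.mem_Iic, not_le.mpr hs, and_false,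
      Set.mem_empty_iff_false]
  have hconn : IsPreconnected (closure (Set.range γ)) := (isPreconnected_range hcont).closure
  refine hconn.subset_connectedComponent ?_ ?_
  · exact mem_closure_of_tendsto hbot (Eventually.of_forall fun t => Set.mem_range_self t)
  · exact mem_closure_of_tendsto htop (Eventually.of_forall fun t => Set.mem_range_self t)

/-- If finitely many measurable maps take pairwise distinct values at every point of a non-null
set, they have pairwise disjoint images on a non-null subset: the values can be told apart by their
approximations in some precision `1 / N` and there are only countably many approximations. -/
theorem exists_isTower {E : ι → Equiv.Perm X} (hE : ∀ i, Measurable (E i)) {C : Set X}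
    (hC : MeasurableSet C) (hC0 : μ C ≠ 0) (hinj : ∀ x ∈ C, Function.Injective fun i => E i x) :
    ∃ B ⊆ C, MeasurableSet B ∧ μ B ≠ 0 ∧ IsTower E B := by
  have := Fintype.ofFinite ι
  set g := embeddingReal X
  have hg : MeasurableEmbedding g := measurableEmbedding_embeddingReal X
  set D : ℕ × {k : ι → ℤ // Function.Injective k} → Set X := fun p =>
    C ∩ ⋂ i, {x | ⌊(p.1 : ℝ) * g (E i x)⌋ = p.2.1 i} with hD
  have hcov : C ⊆ ⋃ p, D p := by
    intro x hx
    have hN : ∃ N : ℕ, ∀ q : ι × ι, q.1 ≠ q.2 → 1 ≤ (N : ℝ) * |g (E q.1 x) - g (E q.2 x)| := by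
      have h1 : ∀ q : ι × ι, ∀ᶠ N : ℕ in atTop,
          q.1 ≠ q.2 → 1 ≤ (N : ℝ) * |g (E q.1 x) - g (E q.2 x)| := by
        intro q
        by_cases hq : q.1 = q.2
        · exact Eventually.of_forall fun N h => absurd hq h
        have hpos : 0 < |g (E q.1 x) - g (E q.2 x)| := by
          rw [abs_pos, sub_ne_zero]
          exact fun h => hq (hinj x hx (hg.injective h))
        filter_upwards [(tendsto_natCast_atTop_atTop.atTop_mul_const hpos).eventually_ge_atTop 1]
          with N hN _ using hN
      exact (eventually_all.mpr h1).exists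
    obtain ⟨N, hN⟩ := hN
    refine Set.mem_iUnion.mpr ⟨⟨N, fun i => ⌊(N : ℝ) * g (E i x)⌋, fun i j hij => ?_⟩, hx,
      Set.mem_iInter.mpr fun i => rfl⟩
    by_contra hne
    have h2 := Int.abs_sub_lt_one_of_floor_eq_floor hij
    have h3 := hN (i, j) hne
    rw [← mul_sub, abs_mul, Nat.abs_cast] at h2
    exact absurd h2 (not_lt.mpr h3)
  obtain ⟨p, hp⟩ := exists_measure_pos_of_not_measure_iUnion_null (μ := μ) (s := D)
    fun h0 => hC0 (measure_mono_null hcov h0)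
  refine ⟨D p, Set.inter_subset_left, hC.inter (MeasurableSet.iInter fun i => ?_), hp.ne', ?_⟩
  · have : Measurable fun x => ⌊(p.1 : ℝ) * g (E i x)⌋ :=
      Int.measurable_floor.comp ((hg.measurable.comp (hE i)).const_mul _)
    exact this (measurableSet_singleton (p.2.1 i))
  · intro x hx y hy i j hij
    have h1 : ⌊(p.1 : ℝ) * g (E i x)⌋ = p.2.1 i := Set.mem_iInter.mp hx.2 i
    have h2 : ⌊(p.1 : ℝ) * g (E j y)⌋ = p.2.1 j := Set.mem_iInter.mp hy.2 j
    rw [hij, h2] at h1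
    exact p.2.2 h1.symm

end

/-! ### Periodic elements are limits of products of towers -/

section

variable {X : Type*} [MeasurableSpace X] {μ : Measure X}

/-- A class of measurable sets which is closed under increasing unions, and in which every set that
is not conull can be enlarged by a non-null set, contains a conull set. -/
theorem exists_conull_of_extension [IsFiniteMeasure μ] {Q : Set X → Prop} (h0 : Q ∅)
    (hU : ∀ Y : ℕ → Set X, Monotone Y → (∀ n, Q (Y n)) → Q (⋃ n, Y n))
    (hext : ∀ Y, Q Y → μ Yᶜ ≠ 0 → ∃ Y', Y ⊆ Y' ∧ Q Y' ∧ μ Y < μ Y') :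
    ∃ Y, Q Y ∧ μ Yᶜ = 0 := by
  set R : Set X → Set ℝ := fun Y => (fun Z => μ.real Z) '' {Z | Q Z ∧ Y ⊆ Z} with hR
  have hbdd : ∀ Y, BddAbove (R Y) := fun Y => ⟨μ.real Set.univ, by
    rintro _ ⟨Z, _, rfl⟩
    exact measureReal_mono (Set.subset_univ Z)⟩
  -- each step realizes the largest possible enlargement up to an error tending to zero
  have hnext : ∀ (n : ℕ) (Y : {Y // Q Y}), ∃ Z : {Z // Q Z}, Y.1 ⊆ Z.1 ∧
      sSup (R Y.1) < μ.real Z.1 + 1 / ((n : ℝ) + 1) := by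
    intro n Y
    obtain ⟨_, ⟨Z, ⟨hZ, hYZ⟩, rfl⟩, h⟩ := exists_lt_of_lt_csSup (s := R Y.1)
      ⟨_, Y.1, ⟨Y.2, subset_rfl⟩, rfl⟩
      (sub_lt_self (sSup (R Y.1)) (Nat.one_div_pos_of_nat (n := n) (α := ℝ)))
    exact ⟨⟨Z, hZ⟩, hYZ, by linarith⟩
  choose next hsub hlt using hnext
  set Y : ℕ → {Y // Q Y} := fun n => Nat.rec ⟨∅, h0⟩ (fun n Z => next n Z) n with hY
  have hstep : ∀ n, Y (n + 1) = next n (Y n) := fun n => rfl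
  have hmono : Monotone fun n => (Y n).1 :=
    monotone_nat_of_le_succ fun n => by rw [hstep]; exact hsub n (Y n)
  have hQ : Q (⋃ n, (Y n).1) := hU _ hmono fun n => (Y n).2
  refine ⟨_, hQ, ?_⟩
  by_contra hne
  obtain ⟨Y', hYY', hQ', hlt'⟩ := hext _ hQ hne
  have hδ : 0 < μ.real Y' - μ.real (⋃ n, (Y n).1) :=
    sub_pos.mpr ((ENNReal.toReal_lt_toReal (measure_ne_top _ _) (measure_ne_top _ _)).mpr hlt')
  obtain ⟨n, hn⟩ := exists_nat_one_div_lt hδ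
  have h1 : μ.real Y' ≤ sSup (R (Y n).1) :=
    le_csSup (hbdd _) ⟨Y', ⟨hQ', (Set.subset_iUnion (fun n => (Y n).1) n).trans hYY'⟩, rfl⟩
  have h2 := hlt n (Y n)
  rw [← hstep] at h2
  have h3 : μ.real (Y (n + 1)).1 ≤ μ.real (⋃ n, (Y n).1) :=
    measureReal_mono (Set.subset_iUnion (fun n => (Y n).1) (n + 1))
  linarith

/-- Two commuting copies of a finite permutation form a product of commutators: for a
transposition `u`, the commutator of `u` with the exchange of the copies is two copies of `u`. -/
theorem prodCongr_mem_commutator {α : Type*} [Finite α] (c : Equiv.Perm α) :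
    c.prodCongr (Equiv.refl Bool) ∈ commutator (Equiv.Perm (α × Bool)) := by
  classical
  induction c using Equiv.Perm.swap_induction_on with
  | one =>
    have : (1 : Equiv.Perm α).prodCongr (Equiv.refl Bool) = 1 := rfl
    rw [this]
    exact one_mem _
  | swap_mul f a b hab ih =>
    have hmul : (Equiv.swap a b * f).prodCongr (Equiv.refl Bool) =
        (Equiv.swap a b).prodCongr (Equiv.refl Bool) * f.prodCongr (Equiv.refl Bool) := rfl
    rw [hmul]
    refine mul_mem ?_ ih
    let u : Equiv.Perm (α × Bool) := Equiv.swap (a, false) (b, false)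
    let w : Equiv.Perm (α × Bool) := (Equiv.refl α).prodCongr Equiv.boolNot
    have hcomm : (Equiv.swap a b).prodCongr (Equiv.refl Bool) = u * w * u⁻¹ * w⁻¹ := by
      ext ⟨x, i⟩ : 1
      cases i <;> by_cases ha : x = a <;> by_cases hb : x = b <;>
        simp [u, w, Equiv.swap_apply_def, ha, hb, hab, hab.symm, Equiv.Perm.inv_def]
    rw [hcomm, ← commutatorElement_def]
    exact Subgroup.commutator_mem_commutator (Subgroup.mem_top u) (Subgroup.mem_top w)

/-- The points of minimal period `p` under `s`, when `0 < p`. -/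
def exactPeriod {X : Type*} (s : Equiv.Perm X) (p : ℕ) : Set X :=
  {x | (s ^ p) x = x ∧ ∀ j, 0 < j → j < p → (s ^ j) x ≠ x}

theorem exactPeriod_inj {X : Type*} {s : Equiv.Perm X} {p : ℕ} {x : X}
    (hx : x ∈ exactPeriod s p) {i j : ℕ} (hi : i < p) (hj : j < p) (h : (s ^ i) x = (s ^ j) x) :
    i = j := by
  wlog hij : i ≤ j generalizing i j
  · exact (this hj hi h.symm (by omega)).symm
  by_contra hne
  refine hx.2 (j - i) (by omega) (by omega) ((s ^ i).injective ?_)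
  rw [← Equiv.Perm.mul_apply, ← pow_add, Nat.add_sub_cancel' hij, h]

theorem exists_mem_exactPeriod {X : Type*} {s : Equiv.Perm X} {x : X}
    (hx : x ∈ Function.periodicPts s) : ∃ p, 0 < p ∧ x ∈ exactPeriod s p := by
  classical
  have hex : ∃ p, 0 < p ∧ (s ^ p) x = x := by
    obtain ⟨n, hn, h⟩ := hx
    exact ⟨n, hn, by rw [← Equiv.Perm.iterate_eq_pow]; exact h⟩
  refine ⟨Nat.find hex, (Nat.find_spec hex).1, (Nat.find_spec hex).2, fun j hj hj' h => ?_⟩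
  exact Nat.find_min hex hj' ⟨hj, h⟩

theorem pow_mod_apply {X : Type*} {s : Equiv.Perm X} {p : ℕ} {x : X} (hx : (s ^ p) x = x)
    (m : ℕ) : (s ^ (m % p)) x = (s ^ m) x := by
  have h : Function.IsPeriodicPt s p x := by
    rw [Function.IsPeriodicPt, Function.IsFixedPt, Equiv.Perm.iterate_eq_pow, hx]
  have := h.iterate_mod_apply m
  rwa [Equiv.Perm.iterate_eq_pow, Equiv.Perm.iterate_eq_pow] at this

theorem apply_pow_finRotate {X : Type*} {s : Equiv.Perm X} {p : ℕ} {x : X} (hx : (s ^ p) x = x)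
    (j : Fin p) : s ((s ^ (j : ℕ)) x) = (s ^ ((finRotate p j : Fin p) : ℕ)) x := by
  rcases p with _ | q
  · exact j.elim0
  rw [← Equiv.Perm.mul_apply, ← pow_succ']
  by_cases hj : j = Fin.last q
  · subst hj
    rw [finRotate_last]
    simpa using hx
  · rw [coe_finRotate_of_ne_last hj]

theorem apply_mem_aperiodicPart {T : mpGroup μ} (x : X) :
    T.1 x ∈ aperiodicPart T ↔ x ∈ aperiodicPart T := by
  simpa using zpow_mem_aperiodicPart (T := T) (x := x) 1

variable {T : mpGroup μ} [StandardBorelSpace X]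

/-- The restriction of `T` to its aperiodic part. -/
def aperiodicShift [IsFiniteMeasure μ] (T : mpGroup μ) : intOrbitGroup T :=
  ⟨restrictPerm T.1 (aperiodicPart T) apply_mem_aperiodicPart, by
    have hm := measurableSet_aperiodicPart T
    have horb : ∀ x, ∃ n : ℤ, n.natAbs ≤ 1 ∧ restrictPerm T.1 (aperiodicPart T)
        apply_mem_aperiodicPart x = (T.1 ^ n) x := by
      intro x
      by_cases hx : x ∈ aperiodicPart T
      · exact ⟨1, by simp, by rw [restrictPerm_of_mem hx]; simp⟩
      · exact ⟨0, by simp, by rw [restrictPerm_of_notMem hx]; simp⟩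
    refine ⟨⟨measurable_restrictPerm hm T.2.1.measurable,
      measurable_restrictPerm_symm hm T.2.2.measurable, fun x => ?_, fun x hx =>
      restrictPerm_of_notMem hx⟩, lt_of_le_of_lt (lintegral_mono (g := fun _ => 1) fun x => ?_) ?_⟩
    · obtain ⟨n, _, hn⟩ := horb x
      exact ⟨n, hn⟩
    · obtain ⟨n, hn, h⟩ := horb x
      exact iInf₂_le_of_le n h (Nat.cast_le_one.mpr hn)
    · simp⟩

theorem aperiodicShift_zpow [IsFiniteMeasure μ] {x : X} (hx : x ∈ aperiodicPart T) (n : ℤ) :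
    (aperiodicShift T ^ n).1 x = (T.1 ^ n) x := by
  have h1 : ∀ y, y ∈ aperiodicPart T → (aperiodicShift T).1 y = T.1 y := fun y hy =>
    restrictPerm_of_mem (h := apply_mem_aperiodicPart) hy
  have hnat : ∀ (n : ℕ) y, y ∈ aperiodicPart T → ((aperiodicShift T).1 ^ n) y = (T.1 ^ n) y := by
    intro n
    induction n with
    | zero => intro y _; simp
    | succ n ih =>
      intro y hy
      rw [pow_succ', pow_succ', Equiv.Perm.mul_apply, Equiv.Perm.mul_apply, ih y hy]
      refine h1 _ ?_
      have := (zpow_mem_aperiodicPart (T := T) (x := y) n).mpr hy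
      simpa using this
  have hcoe : (aperiodicShift T ^ n).1 = (aperiodicShift T).1 ^ n := by simp
  rw [hcoe]
  obtain ⟨m, rfl | rfl⟩ := n.eq_nat_or_neg
  · rw [zpow_natCast, zpow_natCast]; exact hnat m x hx
  · rw [zpow_neg, zpow_natCast, Equiv.Perm.inv_eq_iff_eq, hnat]
    · rw [← zpow_natCast, ← zpow_add_apply]; simp
    · rwa [zpow_mem_aperiodicPart]

/-- If `s` has points of period `p` off an `s`-invariant set `Y`, then it acts off `Y` on some tower
as two copies of a cyclic permutation: the levels are `p` consecutive images under `s` of a set and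
of its translate by a power of `T`, which exists by recurrence. -/
theorem exists_double_tower [IsFiniteMeasure μ] (hap : ∀ᵐ x ∂μ, x ∈ aperiodicPart T)
    (s : intOrbitGroup T) (hs : ∀ᵐ x ∂μ, x ∈ Function.periodicPts s.1) {Y : Set X}
    (hY : MeasurableSet Y) (hYs : ∀ x, s.1 x ∈ Y ↔ x ∈ Y) (hY0 : μ Yᶜ ≠ 0) :
    ∃ (p : ℕ) (E : Fin p × Bool → intOrbitGroup T) (B : Set X), 0 < p ∧ MeasurableSet B ∧
      μ B ≠ 0 ∧ IsTower (fun i => (E i).1) B ∧ (∀ x ∈ B, ∀ i, (E i).1 x ∉ Y) ∧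
      ∀ x ∈ B, ∀ i, s.1 ((E i).1 x) =
        (E ((finRotate p).prodCongr (Equiv.refl Bool) i)).1 x := by
  have hsm : ∀ n : ℕ, Measurable ⇑(s.1 ^ n) := fun n => (pow_mem s.2.1 n).1
  have hYpow : ∀ (n : ℕ) x, (s.1 ^ n) x ∈ Y ↔ x ∈ Y := by
    intro n
    induction n with
    | zero => intro x; simp
    | succ n ih => intro x; rw [pow_succ', Equiv.Perm.mul_apply, hYs, ih]
  have hEPm : ∀ p, MeasurableSet (exactPeriod s.1 p) := by
    intro p
    refine (measurableSet_eq_fun (hsm p) measurable_id).inter ?_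
    have : {x | ∀ j, 0 < j → j < p → (s.1 ^ j) x ≠ x} =
        ⋂ (j : ℕ) (_ : 0 < j) (_ : j < p), {x | (s.1 ^ j) x ≠ x} := by ext x; simp
    change MeasurableSet {x | ∀ j, 0 < j → j < p → (s.1 ^ j) x ≠ x}
    rw [this]
    exact MeasurableSet.iInter fun j => MeasurableSet.iInter fun _ => MeasurableSet.iInter fun _ =>
      (measurableSet_eq_fun (hsm j) measurable_id).compl
  set C : ℕ → Set X := fun p => aperiodicPart T ∩ Yᶜ ∩ exactPeriod s.1 p with hC
  have hCm : ∀ p, MeasurableSet (C p) := fun p =>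
    ((measurableSet_aperiodicPart T).inter hY.compl).inter (hEPm p)
  obtain ⟨⟨p, hp⟩, hCp⟩ : ∃ p : {p : ℕ // 0 < p}, 0 < μ (C p.1) := by
    refine exists_measure_pos_of_not_measure_iUnion_null fun h0 => hY0 ?_
    refine measure_mono_null_ae ?_ h0
    filter_upwards [hap, hs] with x h1 h2 h3
    obtain ⟨p, hp, h⟩ := exists_mem_exactPeriod h2
    exact Set.mem_iUnion.mpr ⟨⟨p, hp⟩, ⟨h1, h3⟩, h⟩
  set D : ℕ → Set X := fun n => C p ∩ ((T.1 ^ (n : ℤ)) ⁻¹' C p ∩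
    ⋂ j : Fin p, {x | (T.1 ^ (n : ℤ)) x ≠ (s.1 ^ (j : ℕ)) x}) with hD
  have hDm : ∀ n, MeasurableSet (D n) := fun n =>
    (hCm p).inter ((mpGroup_zpow_measurable T n (hCm p)).inter (MeasurableSet.iInter fun j =>
      (measurableSet_eq_fun (mpGroup_zpow_measurable T n) (hsm j)).compl))
  obtain ⟨n, hDn⟩ : ∃ n, 0 < μ (D n) := by
    refine exists_measure_pos_of_not_measure_iUnion_null fun h0 => hCp.ne' ?_
    refine measure_mono_null_ae ?_ h0
    filter_upwards [T.2.1.conservative.ae_mem_imp_frequently_image_mem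
      (hCm p).nullMeasurableSet] with x hx hxC
    obtain ⟨n, hn, hnC⟩ := (hx hxC).forall_exists_of_atTop
      (1 + ∑ j : Fin p, (coc T (s.1 ^ (j : ℕ)) x).natAbs)
    rw [Equiv.Perm.iterate_eq_pow, ← zpow_natCast] at hnC
    refine Set.mem_iUnion.mpr ⟨n, hxC, hnC, Set.mem_iInter.mpr fun j hj => ?_⟩
    have h1 : coc T (s.1 ^ (j : ℕ)) x = n := coc_eq hxC.1.1 hj.symm
    have h2 : (coc T (s.1 ^ (j : ℕ)) x).natAbs ≤ ∑ j : Fin p, (coc T (s.1 ^ (j : ℕ)) x).natAbs :=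
      Finset.single_le_sum (f := fun j : Fin p => (coc T (s.1 ^ (j : ℕ)) x).natAbs)
        (fun _ _ => Nat.zero_le _) (Finset.mem_univ j)
    rw [h1] at h2
    simp only [Int.natAbs_natCast] at h2
    omega
  set E : Fin p × Bool → intOrbitGroup T := fun i =>
    s ^ (i.1 : ℕ) * (if i.2 then aperiodicShift T ^ (n : ℤ) else 1) with hE
  have hEf : ∀ (j : Fin p) x, (E (j, false)).1 x = (s.1 ^ (j : ℕ)) x := by
    intro j x; simp [hE]
  have hEt : ∀ (j : Fin p) x, x ∈ aperiodicPart T →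
      (E (j, true)).1 x = (s.1 ^ (j : ℕ)) ((T.1 ^ (n : ℤ)) x) := by
    intro j x hx
    have := aperiodicShift_zpow hx (n : ℤ)
    rw [← this]
    simp [hE]
  have hcross : ∀ x ∈ D n, ∀ i j : Fin p,
      (s.1 ^ (i : ℕ)) x ≠ (s.1 ^ (j : ℕ)) ((T.1 ^ (n : ℤ)) x) := by
    intro x hx i j h
    have h1 : (s.1 ^ (p - (j : ℕ) + i)) x = (T.1 ^ (n : ℤ)) x := by
      rw [pow_add, Equiv.Perm.mul_apply, h, ← Equiv.Perm.mul_apply, ← pow_add,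
        Nat.sub_add_cancel j.2.le]
      exact hx.2.1.2.1
    rw [← pow_mod_apply hx.1.2.1] at h1
    exact Set.mem_iInter.mp hx.2.2 ⟨_, Nat.mod_lt _ hp⟩ h1.symm
  have hinj : ∀ x ∈ D n, Function.Injective fun i => (E i).1 x := by
    rintro x hx ⟨i, b⟩ ⟨j, b'⟩ h
    have hxa := hx.1.1.1
    cases b <;> cases b' <;> simp only [hEf, hEt _ _ hxa] at h
    · rw [Fin.ext (exactPeriod_inj hx.1.2 i.2 j.2 h)]
    · exact absurd h (hcross x hx i j)
    · exact absurd h.symm (hcross x hx j i)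
    · rw [Fin.ext (exactPeriod_inj hx.2.1.2 i.2 j.2 h)]
  obtain ⟨B, hBD, hBm, hB0, hBt⟩ := exists_isTower (fun i => (E i).2.1.1) (hDm n) hDn.ne' hinj
  refine ⟨p, E, B, hp, hBm, hB0, hBt, ?_, ?_⟩
  · rintro x hx ⟨j, b⟩
    have hxD := hBD hx
    cases b
    · rw [hEf, hYpow]; exact hxD.1.1.2
    · rw [hEt _ _ hxD.1.1.1, hYpow]; exact hxD.2.1.1.2
  · rintro x hx ⟨j, b⟩
    have hxD := hBD hx
    cases b
    · rw [hEf, apply_pow_finRotate hxD.1.2.1]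
      exact (hEf _ x).symm
    · rw [hEt _ _ hxD.1.1.1, apply_pow_finRotate hxD.2.1.2.1]
      exact (hEt _ x hxD.1.1.1).symm

/-- A closed subgroup which contains the actions on towers of all products of commutators of finite
permutations contains all periodic elements. -/
theorem toL1_mem_of_periodic [IsFiniteMeasure μ] (hap : ∀ᵐ x ∂μ, x ∈ aperiodicPart T)
    {G : Subgroup (L1FullGroup T)} (hGc : IsClosed (G : Set (L1FullGroup T)))
    (hG : ∀ (ι : Type) [Finite ι] (E : ι → intOrbitGroup T) (B : Set X) (hB : MeasurableSet B)
      (hE : IsTower (fun i => (E i).1) B) (σ : Equiv.Perm ι), σ ∈ commutator (Equiv.Perm ι) →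
      toL1 T (towerHom E B hB hE σ) ∈ G)
    (s : intOrbitGroup T) (hs : ∀ᵐ x ∂μ, x ∈ Function.periodicPts s.1) : toL1 T s ∈ G := by
  set Q : Set X → Prop := fun Y => ∃ (hY : MeasurableSet Y) (h : ∀ x, s.1 x ∈ Y ↔ x ∈ Y),
    toL1 T ⟨restrictPerm s.1 Y h, restrictPerm_mem s.2 hY h⟩ ∈ G with hQ
  obtain ⟨Y, ⟨hY, hYs, hYG⟩, hY0⟩ : ∃ Y, Q Y ∧ μ Yᶜ = 0 := by
    refine exists_conull_of_extension ?_ ?_ ?_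
    · refine ⟨MeasurableSet.empty, fun x => by simp, ?_⟩
      refine (congrArg (· ∈ G) ?_).mpr (one_mem G)
      rw [← map_one (toL1 T)]
      exact toL1_eq_iff.mpr (Eventually.of_forall fun x =>
        restrictPerm_of_notMem (h := fun _ => Iff.rfl) (Set.notMem_empty x))
    · intro Y hmono hYQ
      choose hY hYs hYG using hYQ
      have hUs : ∀ x, s.1 x ∈ ⋃ n, Y n ↔ x ∈ ⋃ n, Y n := fun x => by
        simp only [Set.mem_iUnion, hYs]
      refine ⟨MeasurableSet.iUnion hY, hUs, ?_⟩
      refine hGc.mem_of_tendsto (f := fun n => toL1 T ⟨restrictPerm s.1 (Y n) (hYs n),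
        restrictPerm_mem s.2 (hY n) (hYs n)⟩) (b := atTop) ?_ (Eventually.of_forall hYG)
      refine tendsto_toL1 s.2.2.ne (fun n x => ?_) (Eventually.of_forall fun x => ?_)
      · change orbitDist T.1 (restrictPerm s.1 (Y n) (hYs n) x)
          (restrictPerm s.1 (⋃ n, Y n) hUs x) ≤ _
        by_cases hx : x ∈ ⋃ n, Y n
        · rw [restrictPerm_of_mem hx]
          by_cases hxn : x ∈ Y n
          · rw [restrictPerm_of_mem hxn, orbitDist_self]; exact zero_le
          · rw [restrictPerm_of_notMem hxn]
        · rw [restrictPerm_of_notMem hx,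
            restrictPerm_of_notMem fun h => hx (Set.mem_iUnion.mpr ⟨n, h⟩), orbitDist_self]
          exact zero_le
      · change ∀ᶠ n in atTop, restrictPerm s.1 (Y n) (hYs n) x =
          restrictPerm s.1 (⋃ n, Y n) hUs x
        by_cases hx : x ∈ ⋃ n, Y n
        · obtain ⟨m, hm⟩ := Set.mem_iUnion.mp hx
          filter_upwards [eventually_ge_atTop m] with n hn
          rw [restrictPerm_of_mem hx, restrictPerm_of_mem (hmono hn hm)]
        · refine Eventually.of_forall fun n => ?_
          rw [restrictPerm_of_notMem hx,
            restrictPerm_of_notMem fun h => hx (Set.mem_iUnion.mpr ⟨n, h⟩)]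
    · rintro Y ⟨hY, hYs, hYG⟩ hY0
      obtain ⟨p, E, B, hp, hB, hB0, hE, hEY, hEs⟩ := exists_double_tower hap s hs hY hYs hY0
      set σ := (finRotate p).prodCongr (Equiv.refl Bool) with hσ
      set L : Set X := ⋃ i, ⇑((E i).1⁻¹) ⁻¹' B with hL
      have hLm : MeasurableSet L := MeasurableSet.iUnion fun i => (inv_mem (E i).2.1).1 hB
      have hLmem : ∀ z, z ∈ L ↔ ∃ i, ∃ x ∈ B, z = (E i).1 x := by
        intro z
        simp only [hL, Set.mem_iUnion, Set.mem_preimage]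
        refine exists_congr fun i => ⟨fun h => ⟨_, h, by simp⟩, ?_⟩
        rintro ⟨x, hx, rfl⟩
        simpa using hx
      have hLY : ∀ z ∈ L, z ∉ Y := by
        intro z hz
        obtain ⟨i, x, hx, rfl⟩ := (hLmem z).mp hz
        exact hEY x hx i
      have hLs : ∀ z, s.1 z ∈ L ↔ z ∈ L := by
        intro z
        constructor
        · intro hz
          obtain ⟨i, x, hx, h⟩ := (hLmem _).mp hz
          refine (hLmem z).mpr ⟨σ.symm i, x, hx, s.1.injective ?_⟩
          rw [h, hEs x hx, Equiv.apply_symm_apply]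
        · intro hz
          obtain ⟨i, x, hx, rfl⟩ := (hLmem z).mp hz
          rw [hEs x hx]
          exact (hLmem _).mpr ⟨_, x, hx, rfl⟩
      have hYL : ∀ x, s.1 x ∈ Y ∪ L ↔ x ∈ Y ∪ L := fun x => by
        simp only [Set.mem_union, hYs, hLs]
      refine ⟨Y ∪ L, Set.subset_union_left, ⟨hY.union hLm, hYL, ?_⟩, ?_⟩
      · have hmul : toL1 T ⟨restrictPerm s.1 (Y ∪ L) hYL, restrictPerm_mem s.2 (hY.union hLm) hYL⟩ =
            toL1 T (towerHom E B hB hE σ) *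
              toL1 T ⟨restrictPerm s.1 Y hYs, restrictPerm_mem s.2 hY hYs⟩ := by
          rw [← map_mul]
          refine toL1_eq_iff.mpr (Eventually.of_forall fun z => ?_)
          change restrictPerm s.1 (Y ∪ L) hYL z =
            towerMap (fun i => (E i).1) B σ (restrictPerm s.1 Y hYs z)
          have hfix : ∀ w, w ∉ L → towerMap (fun i => (E i).1) B σ w = w := fun w hw =>
            towerMap_of_notMem σ fun i hi => hw (Set.mem_iUnion.mpr ⟨i, hi⟩)
          by_cases hzY : z ∈ Y
          · rw [restrictPerm_of_mem (Set.mem_union_left L hzY), restrictPerm_of_mem hzY, hfix]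
            exact fun h => hLY _ h ((hYs z).mpr hzY)
          · rw [restrictPerm_of_notMem hzY]
            by_cases hzL : z ∈ L
            · rw [restrictPerm_of_mem (Set.mem_union_right Y hzL)]
              obtain ⟨i, x, hx, rfl⟩ := (hLmem z).mp hzL
              rw [hEs x hx, hE.towerMap_apply σ i hx]
            · rw [hfix z hzL, restrictPerm_of_notMem]
              exact fun h => h.elim hzY hzL
        rw [hmul]
        exact mul_mem (hG _ E B hB hE σ (prodCongr_mem_commutator _)) hYG
      · rw [measure_union (Set.disjoint_left.mpr fun z hz hz' => hLY z hz' hz) hLm]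
        refine ENNReal.lt_add_right (measure_ne_top _ _) fun h0 => hB0 ?_
        have hEB := (orbitGroup_measurePreserving (inv_mem (E (⟨0, hp⟩, false)).2.1)).measure_preimage
          hB.nullMeasurableSet
        rw [← hEB]
        exact measure_mono_null (Set.subset_iUnion (fun i => ⇑((E i).1⁻¹) ⁻¹' B) _) h0
  refine (congrArg (· ∈ G) ?_).mpr hYG
  refine toL1_eq_iff.mpr ?_
  have : ∀ᵐ x ∂μ, x ∈ Y := by
    rw [ae_iff]; exact hY0
  filter_upwards [this] with x hx
  exact (restrictPerm_of_mem hx).symm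

end

/-! ### Elements of index zero are products of two periodic elements -/

section

variable {X : Type*} [MeasurableSpace X] {μ : Measure X}

theorem exists_perm_exchange {α : Type*} {L R : Finset α} (hd : Disjoint L R)
    (hc : L.card = R.card) : ∃ σ : Equiv.Perm α, (∀ a ∈ L, σ a ∈ R) ∧ (∀ a ∈ R, σ a ∈ L) ∧
      ∀ a, a ∉ L → a ∉ R → σ a = a := by
  classical
  let e : L ≃ R := Finset.equivOfCardEq hc
  let f : α → α := fun a =>
    if h : a ∈ L then e ⟨a, h⟩ else if h : a ∈ R then e.symm ⟨a, h⟩ else a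
  have hL : ∀ a (h : a ∈ L), f a = e ⟨a, h⟩ := fun a h => dif_pos h
  have hR : ∀ a (h : a ∈ R), f a = e.symm ⟨a, h⟩ := fun a h => by
    have h' : a ∉ L := Finset.disjoint_right.mp hd h
    simp [f, h, h']
  have h0 : ∀ a, a ∉ L → a ∉ R → f a = a := fun a h h' => by simp [f, h, h']
  have hf : Function.Involutive f := by
    intro a
    by_cases h : a ∈ L
    · rw [hL a h, hR _ (e ⟨a, h⟩).2]; simp
    by_cases h' : a ∈ R
    · rw [hR a h', hL _ (e.symm ⟨a, h'⟩).2]; simp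
    · rw [h0 a h h', h0 a h h']
  refine ⟨hf.toPerm, fun a h => ?_, fun a h => ?_, h0⟩
  · change f a ∈ R
    rw [hL a h]; exact Subtype.prop _
  · change f a ∈ L
    rw [hR a h]; exact Subtype.prop _

theorem crossing_eq_one_iff {c m : ℤ} : crossing c m = 1 ↔ m < 0 ∧ 0 ≤ m + c := by
  unfold crossing; split_ifs <;> omega

theorem crossing_eq_neg_one_iff {c m : ℤ} : crossing c m = -1 ↔ 0 ≤ m ∧ m + c < 0 := by
  unfold crossing; split_ifs <;> omega

/-- If the total flux vanishes, as many points cross the cut to the right as to the left. -/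
theorem exists_crossing_finsets {c : ℤ → ℤ} (hfin : {m | crossing (c m) m ≠ 0}.Finite)
    (hsum : HasSum (fun m => (crossing (c m) m : ℝ)) 0) :
    ∃ L R : Finset ℤ, L.card = R.card ∧
      ∀ m, (crossing (c m) m = 1 ↔ m ∈ L) ∧ (crossing (c m) m = -1 ↔ m ∈ R) := by
  classical
  set S := hfin.toFinset with hS
  have hmem : ∀ m, m ∈ S ↔ crossing (c m) m ≠ 0 := fun m => by simp [hS]
  have h1 : ∑ m ∈ S, (crossing (c m) m : ℝ) = 0 := by
    refine (hasSum_sum_of_ne_finset_zero fun m hm => ?_).unique hsum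
    have : crossing (c m) m = 0 := by
      by_contra h
      exact hm ((hmem m).mpr h)
    rw [this, Int.cast_zero]
  have h2 : ∑ m ∈ S, crossing (c m) m = 0 := by exact_mod_cast h1
  have h3 : ∀ m, crossing (c m) m =
      (if crossing (c m) m = 1 then 1 else 0) - (if crossing (c m) m = -1 then 1 else 0) := by
    intro m
    unfold crossing; split_ifs <;> omega
  refine ⟨S.filter fun m => crossing (c m) m = 1, S.filter fun m => crossing (c m) m = -1, ?_,
    fun m => ?_⟩
  · rw [Finset.sum_congr rfl fun m _ => h3 m, Finset.sum_sub_distrib, Finset.sum_boole,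
      Finset.sum_boole] at h2
    have := sub_eq_zero.mp h2
    exact_mod_cast this
  · simp only [Finset.mem_filter, hmem]
    constructor <;> constructor
    · exact fun h => ⟨by omega, h⟩
    · exact fun h => h.2
    · exact fun h => ⟨by omega, h⟩
    · exact fun h => h.2

theorem linePerm_zpow {T : mpGroup μ} {e : Equiv.Perm X} (he : e ∈ orbitGroup T) (x : X)
    (k m : ℤ) : linePerm he ((T.1 ^ k) x) m = linePerm he x (m + k) - k := by
  rw [linePerm_apply, linePerm_apply, zpow_add_apply]
  ring

/-- If `e` does not move any point of the orbit of `y` across two cuts on either side of `y`, then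
`y` stays between the cuts, so it is periodic. -/
theorem mem_periodicPts_of_cuts {T : mpGroup μ} {e : Equiv.Perm X} (he : e ∈ orbitGroup T) {y : X}
    {k l : ℤ} (hk : k ≤ 0) (hl : 0 < l)
    (h1 : ∀ m, linePerm he ((T.1 ^ k) y) m < 0 ↔ m < 0)
    (h2 : ∀ m, linePerm he ((T.1 ^ l) y) m < 0 ↔ m < 0) : y ∈ Function.periodicPts e := by
  have hcut : ∀ j, (∀ m, linePerm he ((T.1 ^ j) y) m < 0 ↔ m < 0) →
      ∀ m, linePerm he y m < j ↔ m < j := by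
    intro j h m
    have := h (m - j)
    rw [linePerm_zpow, sub_add_cancel] at this
    omega
  have hinv : ∀ m, linePerm he y m ∈ Set.Ico k l ↔ m ∈ Set.Ico k l := by
    intro m
    have h3 := hcut k h1 m
    have h4 := hcut l h2 m
    simp only [Set.mem_Ico]
    omega
  set π : Equiv.Perm (Set.Ico k l) := (linePerm he y).subtypePerm hinv with hπ
  have hpow : ∀ n : ℕ, (T.1 ^ ((π ^ n) ⟨0, hk, hl⟩).1) y = (e ^ n) y := by
    intro n
    induction n with
    | zero => simp
    | succ n ih =>
      rw [pow_succ', pow_succ', Equiv.Perm.mul_apply, Equiv.Perm.mul_apply, ← ih,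
        ← zpow_linePerm he]
      rfl
  refine ⟨orderOf π, orderOf_pos π, ?_⟩
  have := hpow (orderOf π)
  rw [pow_orderOf_eq_one] at this
  rw [Function.IsPeriodicPt, Function.IsFixedPt, Equiv.Perm.iterate_eq_pow, ← this]
  simp

/-- Almost every orbit of an ergodic transformation visits a non-null set arbitrarily far in both
directions. -/
theorem ae_exists_zpow_mem [IsFiniteMeasure μ] {T : mpGroup μ} (hT : Ergodic T.1 μ) {B : Set X}
    (hB : MeasurableSet B) (hB0 : μ B ≠ 0) :
    ∀ᵐ y ∂μ, (∃ k : ℤ, k ≤ 0 ∧ (T.1 ^ k) y ∈ B) ∧ ∃ k : ℤ, 0 < k ∧ (T.1 ^ k) y ∈ B := by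
  set A : Set X := ⋃ k : ℤ, (T.1 ^ k) ⁻¹' B with hA
  have hAm : MeasurableSet A := MeasurableSet.iUnion fun k => mpGroup_zpow_measurable T k hB
  have hAinv : T.1 ⁻¹' A = A := by
    ext x
    simp only [hA, Set.mem_preimage, Set.mem_iUnion]
    constructor
    · rintro ⟨k, hk⟩
      exact ⟨k + 1, by rwa [zpow_add_apply, zpow_one]⟩
    · rintro ⟨k, hk⟩
      refine ⟨k + -1, ?_⟩
      rw [zpow_add_apply]
      simpa using hk
  have hAe : ∀ᵐ x ∂μ, x ∈ A := by
    rcases hT.toPreErgodic.ae_empty_or_univ hAm hAinv with h | h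
    · exfalso
      refine hB0 (measure_mono_null ?_ (ae_eq_empty.mp h))
      exact fun x hx => Set.mem_iUnion.mpr ⟨0, by simpa using hx⟩
    · filter_upwards [h] with x hx using hx.mpr trivial
  have hrec : ∀ k : ℤ, ∀ᵐ x ∂μ, (T.1 ^ k) x ∈ B →
      (∃ n : ℤ, n ≤ 0 ∧ (T.1 ^ n) x ∈ B) ∧ ∃ n : ℤ, 0 < n ∧ (T.1 ^ n) x ∈ B := by
    intro k
    have hf := (mpGroup_zpow_mp T 1).conservative.ae_mem_imp_frequently_image_mem
      hB.nullMeasurableSet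
    have hb := (mpGroup_zpow_mp T (-1)).conservative.ae_mem_imp_frequently_image_mem
      hB.nullMeasurableSet
    filter_upwards [(mpGroup_zpow_mp T k).quasiMeasurePreserving.ae hf,
      (mpGroup_zpow_mp T k).quasiMeasurePreserving.ae hb] with x hf hb hx
    constructor
    · obtain ⟨n, hn, h⟩ := (hb hx).forall_exists_of_atTop k.natAbs
      rw [Equiv.Perm.iterate_eq_pow, ← zpow_natCast, ← zpow_mul, ← zpow_add_apply] at h
      exact ⟨_, by omega, h⟩
    · obtain ⟨n, hn, h⟩ := (hf hx).forall_exists_of_atTop (k.natAbs + 1)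
      rw [Equiv.Perm.iterate_eq_pow, ← zpow_natCast, ← zpow_mul, ← zpow_add_apply] at h
      exact ⟨_, by omega, h⟩
  filter_upwards [hAe, ae_all_iff.mpr hrec] with x hx h
  obtain ⟨k, hk⟩ := Set.mem_iUnion.mp hx
  exact h k hk

variable [StandardBorelSpace X] {T : mpGroup μ}

theorem integral_coc_inv (s : intOrbitGroup T) :
    ∫ x, (coc T (s⁻¹).1 x : ℝ) ∂μ = - ∫ x, (coc T s.1 x : ℝ) ∂μ := by
  have h := integral_coc_mul s⁻¹ s
  rw [inv_mul_cancel] at h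
  have h1 : ∫ x, (coc T (1 : intOrbitGroup T).1 x : ℝ) ∂μ = 0 := by
    simp [coc_one]
  linarith

/-- Suppose that over every point of the base `B` of the tower with levels `T ^ a '' B`, `|a| ≤ M`,
exactly the points of `L`, to the left of the cut at `0`, and of `R`, to its right, are moved
across the cut by `s⁻¹`. Then exchanging `L` and `R` after applying `s` yields a permutation that
moves no point across the cut. -/
theorem linePerm_exchange_lt_zero_iff {s P : intOrbitGroup T} {B : Set X} {L R : Finset ℤ} {M : ℕ}
    {σ : Equiv.Perm ℤ} (hL : ∀ a ∈ L, σ a ∈ R) (hR : ∀ a ∈ R, σ a ∈ L)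
    (h0 : ∀ a, a ∉ L → a ∉ R → σ a = a)
    (hM : ∀ a, a ∈ L ∨ a ∈ R → a ∈ Finset.Icc (-M : ℤ) M) (hW : ∀ a, σ a ∈ Finset.Icc (-M : ℤ) M ↔
      a ∈ Finset.Icc (-M : ℤ) M)
    (hBa : ∀ x ∈ B, x ∈ aperiodicPart T)
    (hcross : ∀ x ∈ B, ∀ m, (crossing (coc T (s⁻¹).1 ((T.1 ^ m) x)) m = 1 ↔ m ∈ L) ∧
      (crossing (coc T (s⁻¹).1 ((T.1 ^ m) x)) m = -1 ↔ m ∈ R))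
    (htow : ∀ x ∈ B, ∀ y ∈ B, ∀ a ∈ Finset.Icc (-M : ℤ) M, ∀ b ∈ Finset.Icc (-M : ℤ) M,
      (T.1 ^ a) x = (T.1 ^ b) y → a = b)
    (hP : ∀ x ∈ B, ∀ a ∈ Finset.Icc (-M : ℤ) M, P.1 ((T.1 ^ a) x) = (T.1 ^ σ a) x)
    (hP' : ∀ z, P.1 z ≠ z → ∃ x ∈ B, ∃ a ∈ Finset.Icc (-M : ℤ) M, z = (T.1 ^ a) x)
    {x : X} (hx : x ∈ B) (m : ℤ) : linePerm (P * s).2.1 x m < 0 ↔ m < 0 := by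
  have hxa := hBa x hx
  have hmul : linePerm (P * s).2.1 x m = linePerm P.2.1 x (linePerm s.2.1 x m) := by
    have := linePerm_mul P.2.1 s.2.1 x
    exact congrArg (fun e : Equiv.Perm ℤ => e m) this
  set j := linePerm s.2.1 x m with hj
  have hjm : j + coc T (s⁻¹).1 ((T.1 ^ j) x) = m :=
    (linePerm s.2.1 x).symm_apply_apply m
  rw [hmul]
  have hspec := zpow_linePerm P.2.1 x j
  obtain ⟨hc1, hc2⟩ := hcross x hx j
  have hcL := crossing_eq_one_iff.symm.trans hc1
  have hcR := crossing_eq_neg_one_iff.symm.trans hc2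
  rw [hjm] at hcL hcR
  by_cases hjW : j ∈ Finset.Icc (-M : ℤ) M
  · rw [hP x hx j hjW] at hspec
    rw [aperiodicPart_inj hxa hspec]
    by_cases hjL : j ∈ L
    · have h1 := hcL.mpr hjL
      have h2 := crossing_eq_neg_one_iff.mp ((hcross x hx _).2.mpr (hL j hjL))
      omega
    by_cases hjR : j ∈ R
    · have h1 := hcR.mpr hjR
      have h2 := crossing_eq_one_iff.mp ((hcross x hx _).1.mpr (hR j hjR))
      omega
    · rw [h0 j hjL hjR]
      have h1 := mt hcL.mp hjL
      have h2 := mt hcR.mp hjR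
      omega
  -- Any window that contains `j` is disjoint from the one around `x`, hence lies entirely on one
  -- side of the cut.
  · have hjL : j ∉ L := fun h => hjW (hM j (Or.inl h))
    have hjR : j ∉ R := fun h => hjW (hM j (Or.inr h))
    have h1 := mt hcL.mp hjL
    have h2 := mt hcR.mp hjR
    have key : linePerm P.2.1 x j < 0 ↔ j < 0 := by
      by_cases hfix : P.1 ((T.1 ^ j) x) = (T.1 ^ j) x
      · rw [hfix] at hspec
        rw [aperiodicPart_inj hxa hspec]
      obtain ⟨y, hy, i, hi, hz⟩ := hP' _ hfix
      have hyx : y = (T.1 ^ (j - i)) x := by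
        rw [sub_eq_neg_add, zpow_add_apply, hz, ← zpow_add_apply]
        simp
      rw [hz, hP y hy i hi, hyx, ← zpow_add_apply] at hspec
      rw [aperiodicPart_inj hxa hspec]
      have hσi := (hW i).mpr hi
      simp only [Finset.mem_Icc] at hi hσi hjW
      have hfar : ¬ (-(2 * M : ℤ) ≤ j - i ∧ j - i ≤ 2 * M) := by
        rintro ⟨h3, h4⟩
        rcases le_total 0 (j - i) with h5 | h5
        · have := htow x hx y hy (-M + (j - i)) (Finset.mem_Icc.mpr (by omega)) (-M)
            (Finset.mem_Icc.mpr (by omega)) (by rw [hyx, ← zpow_add_apply])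
          omega
        · have := htow x hx y hy (M + (j - i)) (Finset.mem_Icc.mpr (by omega)) M
            (Finset.mem_Icc.mpr (by omega)) (by rw [hyx, ← zpow_add_apply])
          omega
      omega
    omega

/-- An element of index zero becomes periodic after composition with a periodic element. On a
non-null set of points the finitely many points crossing the cut at the point in each direction are
the same, and equally many. Exchanging them over the base of a tower closes the cut, and almost
every orbit is cut into finite intervals in this way. -/
theorem exists_periodic_mul_periodic [IsProbabilityMeasure μ] (hT : Ergodic T.1 μ)
    (hap : ∀ᵐ x ∂μ, x ∈ aperiodicPart T) (s : intOrbitGroup T)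
    (hs : ∫ x, (coc T s.1 x : ℝ) ∂μ = 0) :
    ∃ P : intOrbitGroup T, (∀ᵐ x ∂μ, x ∈ Function.periodicPts P.1) ∧
      ∀ᵐ x ∂μ, x ∈ Function.periodicPts (P * s).1 := by
  have hcr := hasSum_crossing hT s⁻¹
  rw [integral_coc_inv, hs, neg_zero] at hcr
  set A : {p : Finset ℤ × Finset ℤ // p.1.card = p.2.card} → Set X := fun p =>
    aperiodicPart T ∩ ⋂ m : ℤ, {x | (crossing (coc T (s⁻¹).1 ((T.1 ^ m) x)) m = 1 ↔ m ∈ p.1.1) ∧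
      (crossing (coc T (s⁻¹).1 ((T.1 ^ m) x)) m = -1 ↔ m ∈ p.1.2)} with hA
  have hAm : ∀ p, MeasurableSet (A p) := by
    intro p
    refine (measurableSet_aperiodicPart T).inter (MeasurableSet.iInter fun m => ?_)
    exact ((measurable_coc (s⁻¹).2.1).comp (mpGroup_zpow_measurable T m))
      (MeasurableSet.of_discrete (s := {c : ℤ | (crossing c m = 1 ↔ m ∈ p.1.1) ∧
        (crossing c m = -1 ↔ m ∈ p.1.2)}))
  obtain ⟨⟨⟨L, R⟩, hcard⟩, hpos⟩ : ∃ p, 0 < μ (A p) := by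
    refine exists_measure_pos_of_not_measure_iUnion_null fun h0 => ?_
    refine (IsProbabilityMeasure.ne_zero μ) (Measure.measure_univ_eq_zero.mp ?_)
    refine measure_mono_null_ae ?_ h0
    filter_upwards [hap, hcr] with x hx h _
    obtain ⟨L, R, hc, hLR⟩ := exists_crossing_finsets h.1 h.2
    exact Set.mem_iUnion.mpr ⟨⟨⟨L, R⟩, hc⟩, hx, Set.mem_iInter.mpr hLR⟩
  obtain ⟨M, hM⟩ : ∃ M : ℕ, ∀ a, a ∈ L ∨ a ∈ R → a ∈ Finset.Icc (-M : ℤ) M := by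
    refine ⟨(L ∪ R).sup Int.natAbs, fun a ha => ?_⟩
    have := Finset.le_sup (f := Int.natAbs) (Finset.mem_union.mpr ha)
    exact Finset.mem_Icc.mpr (by omega)
  obtain ⟨x0, hx0⟩ : (A ⟨⟨L, R⟩, hcard⟩).Nonempty := nonempty_of_measure_ne_zero hpos.ne'
  have hdisj : Disjoint L R := by
    refine Finset.disjoint_left.mpr fun a haL haR => ?_
    have h := Set.mem_iInter.mp hx0.2 a
    have h1 := crossing_eq_one_iff.mp (h.1.mpr haL)
    have h2 := crossing_eq_neg_one_iff.mp (h.2.mpr haR)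
    omega
  obtain ⟨σ, hσL, hσR, hσ0⟩ := exists_perm_exchange hdisj hcard
  have hσW : ∀ a, σ a ∈ Finset.Icc (-M : ℤ) M ↔ a ∈ Finset.Icc (-M : ℤ) M := by
    intro a
    by_cases haL : a ∈ L
    · exact iff_of_true (hM _ (Or.inr (hσL a haL))) (hM _ (Or.inl haL))
    by_cases haR : a ∈ R
    · exact iff_of_true (hM _ (Or.inl (hσR a haR))) (hM _ (Or.inr haR))
    · rw [hσ0 a haL haR]
  set E : Finset.Icc (-M : ℤ) M → intOrbitGroup T := fun a => aperiodicShift T ^ (a : ℤ) with hE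
  obtain ⟨B, hBA, hBm, hB0, hBt⟩ := exists_isTower (E := fun a => (E a).1)
    (fun a => (E a).2.1.1) (hAm ⟨⟨L, R⟩, hcard⟩) hpos.ne' (by
      intro x hx a b hab
      simp only [hE, aperiodicShift_zpow hx.1] at hab
      exact Subtype.ext (aperiodicPart_inj hx.1 hab))
  have hEx : ∀ x ∈ B, ∀ a, (E a).1 x = (T.1 ^ (a : ℤ)) x := fun x hx a =>
    aperiodicShift_zpow (hBA hx).1 a
  set τ := σ.subtypePerm hσW with hτ
  set P := towerHom E B hBm hBt τ with hP
  refine ⟨P, Eventually.of_forall fun x => ⟨orderOf τ, orderOf_pos τ, ?_⟩, ?_⟩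
  · have h1 : P ^ orderOf τ = 1 := by rw [hP, ← map_pow, pow_orderOf_eq_one, map_one]
    rw [Function.IsPeriodicPt, Function.IsFixedPt, Equiv.Perm.iterate_eq_pow,
      ← SubmonoidClass.coe_pow, h1]
    rfl
  have hcut : ∀ x ∈ B, ∀ m, linePerm (P * s).2.1 x m < 0 ↔ m < 0 := by
    intro x hx m
    refine linePerm_exchange_lt_zero_iff (B := B) (M := M) hσL hσR hσ0 hM hσW
      (fun x hx => (hBA hx).1) (fun x hx => Set.mem_iInter.mp (hBA hx).2) ?_ ?_ ?_ hx m
    · intro x hx y hy a ha b hb hab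
      rw [← hEx x hx ⟨a, ha⟩, ← hEx y hy ⟨b, hb⟩] at hab
      exact congrArg Subtype.val (hBt hx hy hab)
    · intro x hx a ha
      rw [← hEx x hx ⟨a, ha⟩, hP, towerHom_apply, hBt.towerMap_apply τ _ hx]
      exact hEx x hx _
    · intro z hz
      by_contra hno
      refine hz (towerMap_of_notMem τ fun a ha => hno ⟨_, ha, a, a.2, ?_⟩)
      rw [← hEx _ ha a]
      simp
  filter_upwards [ae_exists_zpow_mem hT hBm hB0] with y hy
  obtain ⟨⟨k, hk, hkB⟩, l, hl, hlB⟩ := hy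
  exact mem_periodicPts_of_cuts (P * s).2.1 hk hl (hcut _ hkB) (hcut _ hlB)

end

/-! ### The index homomorphism and its kernel -/

section

variable {X : Type*} [MeasurableSpace X] {μ : Measure X}

variable [StandardBorelSpace X] {T : mpGroup μ}

theorem isPeriodic_toL1_iff (s : intOrbitGroup T) :
    IsPeriodic (toL1 T s).1 ↔ ∀ᵐ x ∂μ, x ∈ Function.periodicPts s.1 := by
  have hmp := orbitGroup_measurePreserving s.2.1
  have hiter : ∀ n : ℕ, ∀ᵐ x ∂μ, (rep (toL1 T s).1)^[n] x = s.1^[n] x := by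
    intro n
    induction n with
    | zero => exact Eventually.of_forall fun x => rfl
    | succ n ih =>
      filter_upwards [rep_toL1 s, hmp.quasiMeasurePreserving.ae ih] with x h1 h2
      rw [Function.iterate_succ_apply, Function.iterate_succ_apply, h1, h2]
  have hall := ae_all_iff.mpr hiter
  constructor
  · intro h
    filter_upwards [h, hall] with x ⟨n, hn, hx⟩ h2
    exact ⟨n, hn, (h2 n).symm.trans hx⟩
  · intro h
    filter_upwards [h, hall] with x ⟨n, hn, hx⟩ h2
    exact ⟨n, hn, (h2 n).trans hx⟩

/-- The index is an integer, since it is the number of points of almost any orbit that cross a cut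
to the right minus the number of those that cross it to the left. -/
theorem exists_int_eq_integral_coc [IsProbabilityMeasure μ] (hT : Ergodic T.1 μ)
    (e : intOrbitGroup T) : ∃ k : ℤ, ∫ x, (coc T e.1 x : ℝ) ∂μ = k := by
  obtain ⟨x, hfin, hsum⟩ := (hasSum_crossing hT e).exists
  refine ⟨∑ m ∈ hfin.toFinset, crossing (coc T e.1 ((T.1 ^ m) x)) m, ?_⟩
  rw [Int.cast_sum]
  refine hsum.unique (hasSum_sum_of_ne_finset_zero fun m hm => ?_)
  have : crossing (coc T e.1 ((T.1 ^ m) x)) m = 0 := by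
    by_contra h
    exact hm (hfin.mem_toFinset.mpr h)
  rw [this, Int.cast_zero]

theorem exists_indexHom [IsProbabilityMeasure μ] (hT : Ergodic T.1 μ)
    (hap : ∀ᵐ x ∂μ, x ∈ aperiodicPart T) : ∃ I : L1FullGroup T →* Multiplicative ℤ,
      ∀ S, index T S = ((Multiplicative.toAdd (I S) : ℤ) : ℝ) := by
  have hint : ∀ S : L1FullGroup T, ∃ k : ℤ, index T S = k := by
    intro S
    obtain ⟨e, rfl⟩ := toL1_surjective hap S
    rw [index_toL1 hap]
    exact exists_int_eq_integral_coc hT e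
  choose k hk using hint
  refine ⟨MonoidHom.mk' (fun S => Multiplicative.ofAdd (k S)) fun S U => ?_, hk⟩
  rw [← ofAdd_add]
  congr 1
  have h : (k (S * U) : ℝ) = k S + k U := by
    rw [← hk, ← hk, ← hk]
    obtain ⟨a, rfl⟩ := toL1_surjective hap S
    obtain ⟨b, rfl⟩ := toL1_surjective hap U
    rw [← map_mul, index_toL1 hap, index_toL1 hap, index_toL1 hap, integral_coc_mul]
  exact_mod_cast h

theorem enorm_index_le (hap : ∀ᵐ x ∂μ, x ∈ aperiodicPart T) (S : L1FullGroup T) :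
    ‖index T S‖ₑ ≤ edist S 1 := by
  obtain ⟨e, rfl⟩ := toL1_surjective hap S
  rw [index_toL1 hap, ← map_one (toL1 T), edist_comm, L1FullGroup.edist_def, l1edist_toL1]
  refine (enorm_integral_le_lintegral_enorm _).trans (le_of_eq (lintegral_congr fun x => ?_))
  rw [enorm_intCast, ← orbitDist_apply e.2.1]
  rfl

/-- The index vanishes on the ball of radius one around the identity, because it is an integer. -/
theorem isOpen_ker_index (hap : ∀ᵐ x ∂μ, x ∈ aperiodicPart T)
    {I : L1FullGroup T →* Multiplicative ℤ}
    (hI : ∀ S, index T S = ((Multiplicative.toAdd (I S) : ℤ) : ℝ)) :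
    IsOpen (I.ker : Set (L1FullGroup T)) := by
  refine Subgroup.isOpen_of_mem_nhds I.ker (g := 1) ?_
  refine mem_of_superset (Metric.eball_mem_nhds 1 one_pos) fun S hS => ?_
  have h : ‖index T S‖ₑ < 1 := (enorm_index_le hap S).trans_lt hS
  rw [hI, enorm_intCast] at h
  have h1 : (Multiplicative.toAdd (I S)).natAbs < 1 := by exact_mod_cast h
  have h2 : Multiplicative.toAdd (I S) = 0 := by omega
  exact MonoidHom.mem_ker.mpr (Multiplicative.toAdd.injective h2)

theorem index_toL1_aperiodicShift [IsProbabilityMeasure μ]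
    (hap : ∀ᵐ x ∂μ, x ∈ aperiodicPart T) : index T (toL1 T (aperiodicShift T)) = 1 := by
  rw [index_toL1 hap]
  have : ∀ᵐ x ∂μ, (coc T (aperiodicShift T).1 x : ℝ) = 1 := by
    filter_upwards [hap] with x hx
    have := aperiodicShift_zpow hx 1
    rw [zpow_one] at this
    rw [coc_eq hx this, Int.cast_one]
  rw [integral_congr_ae this]
  simp

theorem toL1_towerHom_mem_commutator {ι : Type*} [Finite ι] (E : ι → intOrbitGroup T) (B : Set X)
    (hB : MeasurableSet B) (hE : IsTower (fun i => (E i).1) B) {σ : Equiv.Perm ι}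
    (hσ : σ ∈ commutator (Equiv.Perm ι)) :
    toL1 T (towerHom E B hB hE σ) ∈ commutator (L1FullGroup T) := by
  have := Subgroup.mem_map_of_mem ((toL1 T).comp (towerHom E B hB hE)) hσ
  rw [commutator_def, Subgroup.map_commutator] at this
  exact Subgroup.commutator_mono le_top le_top this

theorem toL1_towerHom_mem_closure_involutions {ι : Type*} [Finite ι] (E : ι → intOrbitGroup T)
    (B : Set X) (hB : MeasurableSet B) (hE : IsTower (fun i => (E i).1) B) (σ : Equiv.Perm ι) :
    toL1 T (towerHom E B hB hE σ) ∈
      Subgroup.closure {S : L1FullGroup T | S * S = 1} := by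
  classical
  induction σ using Equiv.Perm.swap_induction_on with
  | one => rw [map_one, map_one]; exact one_mem _
  | swap_mul f a b _ ih =>
    rw [map_mul, map_mul]
    refine mul_mem (Subgroup.subset_closure ?_) ih
    change _ * _ = _
    rw [← map_mul, ← map_mul, Equiv.swap_mul_self, map_one, map_one]

/-- A closed subgroup which contains the actions on towers of all products of commutators of finite
permutations, and lies in the kernel of the index, is the kernel of the index. -/
theorem ker_index_eq [IsProbabilityMeasure μ] (hT : Ergodic T.1 μ)
    (hap : ∀ᵐ x ∂μ, x ∈ aperiodicPart T) {I : L1FullGroup T →* Multiplicative ℤ}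
    (hI : ∀ S, index T S = ((Multiplicative.toAdd (I S) : ℤ) : ℝ))
    {G : Subgroup (L1FullGroup T)} (hGc : IsClosed (G : Set (L1FullGroup T)))
    (hG : ∀ (ι : Type) [Finite ι] (E : ι → intOrbitGroup T) (B : Set X) (hB : MeasurableSet B)
      (hE : IsTower (fun i => (E i).1) B) (σ : Equiv.Perm ι), σ ∈ commutator (Equiv.Perm ι) →
      toL1 T (towerHom E B hB hE σ) ∈ G) (hGI : G ≤ I.ker) :
    G = I.ker ∧ Subgroup.closure {S : L1FullGroup T | IsPeriodic S.1} = I.ker := by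
  have h1 : I.ker ≤ Subgroup.closure {S : L1FullGroup T | IsPeriodic S.1} := by
    intro S hS
    obtain ⟨s, rfl⟩ := toL1_surjective hap S
    have hs : ∫ x, (coc T s.1 x : ℝ) ∂μ = 0 := by
      rw [← index_toL1 hap, hI, MonoidHom.mem_ker.mp hS]
      simp
    obtain ⟨P, hP, hPs⟩ := exists_periodic_mul_periodic hT hap s hs
    have h : toL1 T s = (toL1 T P)⁻¹ * toL1 T (P * s) := by rw [map_mul, inv_mul_cancel_left]
    rw [h]
    exact mul_mem (inv_mem (Subgroup.subset_closure ((isPeriodic_toL1_iff P).mpr hP)))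
      (Subgroup.subset_closure ((isPeriodic_toL1_iff (P * s)).mpr hPs))
  have h2 : Subgroup.closure {S : L1FullGroup T | IsPeriodic S.1} ≤ G := by
    refine (Subgroup.closure_le G).mpr fun S hS => ?_
    obtain ⟨s, rfl⟩ := toL1_surjective hap S
    exact toL1_mem_of_periodic hap hGc hG s ((isPeriodic_toL1_iff s).mp hS)
  exact ⟨le_antisymm hGI (h1.trans h2), le_antisymm (h2.trans hGI) h1⟩

end

end

end L1Full


theorem mainTheorem3 {X : Type*} [MeasurableSpace X] [StandardBorelSpace X]
    (μ : Measure X) [IsProbabilityMeasure μ] [NullSingletonClass μ]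
    (T : L1Full.mpGroup μ) (hT : Ergodic (T : Equiv.Perm X) μ) :
    -- the closure of the derived group is the kernel of the index map
    closure (commutator (L1Full.L1FullGroup T) : Set (L1Full.L1FullGroup T)) =
      {S | L1Full.index T S = 0} ∧
    -- the group generated by the periodic elements
    closure (commutator (L1Full.L1FullGroup T) : Set (L1Full.L1FullGroup T)) =
      (Subgroup.closure {S : L1Full.L1FullGroup T | L1Full.IsPeriodic S.1} :
        Set (L1Full.L1FullGroup T)) ∧
    -- the group topologically generated by the involutions
    closure (commutator (L1Full.L1FullGroup T) : Set (L1Full.L1FullGroup T)) =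
      closure (Subgroup.closure {S : L1Full.L1FullGroup T | S * S = 1} :
        Set (L1Full.L1FullGroup T)) ∧
    -- the connected component of the identity
    closure (commutator (L1Full.L1FullGroup T) : Set (L1Full.L1FullGroup T)) =
      connectedComponent (1 : L1Full.L1FullGroup T) ∧
    -- the index is the integral of an integrable function, takes integer values, and is a
    -- surjective homomorphism onto the integers with the closure of the derived group as kernel
    (∀ S : L1Full.L1FullGroup T,
      Integrable (fun x => (L1Full.cocycle T S.1 x : ℝ)) μ) ∧
    ∃ I : L1Full.L1FullGroup T →* Multiplicative ℤ,
      (∀ S, L1Full.index T S = ((Multiplicative.toAdd (I S) : ℤ) : ℝ)) ∧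
      Function.Surjective I ∧
      (I.ker : Set (L1Full.L1FullGroup T)) =
        closure (commutator (L1Full.L1FullGroup T) : Set (L1Full.L1FullGroup T)) := by
  open L1Full in
  have hap := ae_mem_aperiodicPart hT
  obtain ⟨I, hI⟩ := exists_indexHom hT hap
  have hopen := isOpen_ker_index hap hI
  have hclosed : IsClosed (I.ker : Set (L1FullGroup T)) := Subgroup.isClosed_of_isOpen _ hopen
  have hD : (commutator (L1FullGroup T)).topologicalClosure = I.ker ∧
      Subgroup.closure {S : L1FullGroup T | IsPeriodic S.1} = I.ker :=
    ker_index_eq hT hap hI (Subgroup.isClosed_topologicalClosure _)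
      (fun ι _ E B hB hE σ hσ => Subgroup.le_topologicalClosure _
        (toL1_towerHom_mem_commutator E B hB hE hσ))
      (Subgroup.topologicalClosure_minimal _ (Abelianization.commutator_subset_ker I) hclosed)
  have hinv : (Subgroup.closure {S : L1FullGroup T | S * S = 1}).topologicalClosure = I.ker := by
    refine (ker_index_eq hT hap hI (Subgroup.isClosed_topologicalClosure _)
      (fun ι _ E B hB hE σ _ => Subgroup.le_topologicalClosure _
        (toL1_towerHom_mem_closure_involutions E B hB hE σ))
      (Subgroup.topologicalClosure_minimal _ ((Subgroup.closure_le _).mpr fun S hS => ?_)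
        hclosed)).1
    have h1 : I S * I S = 1 := by rw [← map_mul, show S * S = 1 from hS, map_one]
    have h2 : Multiplicative.toAdd (I S) + Multiplicative.toAdd (I S) = 0 := h1
    exact MonoidHom.mem_ker.mpr (Multiplicative.toAdd.injective (show _ = (0 : ℤ) by omega))
  have hconn : Subgroup.connectedComponentOfOne (L1FullGroup T) = I.ker :=
    (ker_index_eq hT hap hI isClosed_connectedComponent
      (fun ι _ E B hB hE σ _ => toL1_towerHom_mem_connectedComponent E B hB hE σ)
      (IsClopen.connectedComponent_subset ⟨hclosed, hopen⟩ (one_mem I.ker))).1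
  have hcl : closure (commutator (L1FullGroup T) : Set (L1FullGroup T)) = I.ker := by
    rw [← hD.1, Subgroup.topologicalClosure_coe]
  rw [hcl]
  refine ⟨?_, by rw [hD.2], by rw [← hinv, Subgroup.topologicalClosure_coe],
    congrArg (fun G : Subgroup (L1FullGroup T) => (G : Set (L1FullGroup T))) hconn.symm,
    fun S => ?_, I, hI, ?_, rfl⟩
  · ext S
    change S ∈ I.ker ↔ index T S = 0
    rw [hI, Int.cast_eq_zero, MonoidHom.mem_ker]
    exact Iff.rfl
  · obtain ⟨e, rfl⟩ := toL1_surjective hap S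
    refine (integrable_coc e).congr ?_
    filter_upwards [cocycle_toL1 hap e] with x hx
    rw [hx]
  · intro k
    refine ⟨toL1 T (aperiodicShift T) ^ Multiplicative.toAdd k, ?_⟩
    have h1 : ((Multiplicative.toAdd (I (toL1 T (aperiodicShift T))) : ℤ) : ℝ) = 1 := by
      rw [← hI, index_toL1_aperiodicShift hap]
    have h2 : Multiplicative.toAdd (I (toL1 T (aperiodicShift T))) = 1 := by exact_mod_cast h1
    refine Multiplicative.toAdd.injective ?_
    rw [map_zpow, toAdd_zpow, h2]
    simp
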